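/- Let $q=2^m$ with $m$ an odd prime, and let $\mathrm{Tr}:\mathbf F_q\to\mathbf F_2$ be the trace map. In $\mathrm{PG}(2,q)$ consider the nonsingular conic $\mathcal O=\{(\xi,\xi^2,1)\mid \xi\in\mathbf F_q\}\cup\{(0,1,0)\}$, and let $\mathcal E$ be the set of exterior lines, i.e. the lines that meet $\mathcal O$ in no point; $|\mathcal E|=q(q-1)/2$. Every $\ell\in\mathcal E$ can be written uniquely as $\ell=(1,x,y)^\perp=\{(a_0,a_1,a_2)\mid a_0+a_1x+a_2y=0\}$ with $x,y\in\mathbf F_q$. For $\ell=(1,x,y)^\perp$ and $k=(1,z,u)^\perp$ in $\mathcal E$ put $\hat\rho(\ell,k)=x^2u^2+y^2z^2+(x+z)(y+u)$. Let $\mathbf T_0^*=\{a\in\mathbf F_q\setminus\{0\}\mid \mathrm{Tr}(a)=0\}$, let $\Gamma_0=\Delta_0$ be the diagonal of $\mathcal E\times\mathcal E$ and, for $a\in\mathbf T_0^*$, let $$\Gamma_a=\{(\ell,k)\in\mathcal E\times\mathcal E\mid \hat\rho(\ell,k)=a\},\qquad \Delta_a=\bigcup_{i\in C_a}\Gamma_i,\qquad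 C_a=\{a,a^2,a^4,\dots,a^{2^{m-1}}\}.$$ Let $\mathrm{PGL}(2,q)$ and $\mathrm{P\Gamma L}(2,q)$ act on $\mathcal E$ as the setwise stabilizers of $\mathcal O$ in $\mathrm{PGL}(3,q)$ and in $\mathrm{P\Gamma L}(3,q)$. Then the orbits of $\mathrm{PGL}(2,q)$ on $\mathcal E\times\mathcal E$ are $\Gamma_0$ and the $\Gamma_a$, $a\in\mathbf T_0^*$ (the elliptic scheme); the orbits of $\mathrm{P\Gamma L}(2,q)$ on $\mathcal E\times\mathcal E$ are $\Delta_0$ and the distinct sets among the $\Delta_a$, $a\in\mathbf T_0^*$ (the fusion of the elliptic scheme under the Frobenius map). Moreover $(\mathcal E,\{\Delta_a\})$ is a symmetric association scheme, and it is pseudocyclic: the primitive idempotents of its Bose--Mesner algebra (the real algebra generated by the adjacency matrices of the relations) other than $\frac1{|\mathcal E|}J$, where $J$ is the all-one matrix, all have the same rank. -/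

import Mathlib

open scoped LinearAlgebra.Projectivization Pointwise

/-! ### Symmetric association schemes, multiplicities, pseudocyclicity -/

/-- A set `𝓡` of relations on `X` is a (symmetric) association scheme: the relations partition
`X × X`, the diagonal is one of them, each of them is symmetric, and the intersection parameters
exist. -/
structure IsAssociationScheme {X : Type*} (𝓡 : Set (Set (X × X))) : Prop where
  isPartition : Setoid.IsPartition 𝓡
  diagonal_mem : Set.diagonal X ∈ 𝓡
  symmetric : ∀ R ∈ 𝓡, ∀ x y : X, (x, y) ∈ R → (y, x) ∈ R
  intersection : ∀ A ∈ 𝓡, ∀ B ∈ 𝓡, ∀ C ∈ 𝓡, ∃ p : ℕ, ∀ x y : X, (x, y) ∈ C →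
    {z : X | (x, z) ∈ A ∧ (z, y) ∈ B}.ncard = p

/-- The real `0-1` adjacency matrix of a relation on `X`. -/
noncomputable def adjacencyMatrix {X : Type*} (R : Set (X × X)) : Matrix X X ℝ :=
  Matrix.of fun x y => Set.indicator R (fun _ => (1 : ℝ)) (x, y)

/-- The Bose-Mesner algebra: the real algebra generated by the adjacency matrices. -/
noncomputable def boseMesnerAlgebra {X : Type*} [Fintype X] [DecidableEq X]
    (𝓡 : Set (Set (X × X))) : Subalgebra ℝ (Matrix X X ℝ) :=
  Algebra.adjoin ℝ (adjacencyMatrix '' 𝓡)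

/-- `E` is a primitive idempotent of the (commutative) matrix algebra `B`: a nonzero idempotent
of `B` such that no idempotent of `B` lies strictly between `0` and `E`. -/
def IsPrimitiveIdempotent {X : Type*} [Fintype X] [DecidableEq X]
    (B : Subalgebra ℝ (Matrix X X ℝ)) (E : Matrix X X ℝ) : Prop :=
  E ∈ B ∧ E * E = E ∧ E ≠ 0 ∧
    ∀ f ∈ B, f * f = f → E * f = f → f * E = f → f = 0 ∨ f = E

/-- The trivial primitive idempotent `J / |X|`, where `J` is the all-one matrix. -/
noncomputable def trivialIdempotent (X : Type*) [Fintype X] : Matrix X X ℝ :=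
  Matrix.of fun _ _ => ((Fintype.card X : ℝ))⁻¹

/-- The relations `𝓡` form a pseudocyclic association scheme: all the multiplicities, i.e. the
ranks of the primitive idempotents of the Bose-Mesner algebra other than `J / |X|`, are equal. -/
def IsPseudocyclic {X : Type*} [Fintype X] [DecidableEq X] (𝓡 : Set (Set (X × X))) : Prop :=
  IsAssociationScheme 𝓡 ∧ ∃ t : ℕ, ∀ E : Matrix X X ℝ,
    IsPrimitiveIdempotent (boseMesnerAlgebra 𝓡) E → E ≠ trivialIdempotent X → E.rank = t

/-- The orbitals of `G` on `X`: the orbits of the diagonal action on `X × X`. -/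
def orbitals (G X : Type*) [Group G] [MulAction G X] : Set (Set (X × X)) :=
  Set.range fun p : X × X => MulAction.orbit G p

/-! ### The projective plane, the conic and its exterior lines -/

section Plane

variable (F : Type*) [Field F]

/-- The point set of `PG(2,q)`. -/
abbrev ProjPlane : Type _ := ℙ F (Fin 3 → F)

variable {F}

/-- The line `w^⊥` of `PG(2,q)`, as a set of points. -/
def perpLine (w : ProjPlane F) : Set (ProjPlane F) := {p | p.orthogonal w}

/-- The line `(1,x,y)^⊥`. -/
def lineOf (x y : F) : Set (ProjPlane F) :=
  perpLine (Projectivization.mk F ![1, x, y] (fun h => one_ne_zero (congrFun h 0)))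

variable (F)

/-- The conic `{(ξ, ξ², 1)} ∪ {(0, 1, 0)}`. -/
def conic : Set (ProjPlane F) :=
  Set.range (fun ξ : F =>
    (Projectivization.mk F ![ξ, ξ ^ 2, 1] (fun h => one_ne_zero (congrFun h 2)) : ProjPlane F)) ∪
  {Projectivization.mk F ![0, 1, 0] (fun h => one_ne_zero (congrFun h 1))}

/-- The exterior lines: the lines of `PG(2,q)` that meet the conic in no point. -/
def ExteriorLine : Type _ :=
  {l : Set (ProjPlane F) // (∃ w, l = perpLine w) ∧ l ∩ conic F = ∅}

noncomputable instance [Finite F] : Fintype (ExteriorLine F) :=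
  @Fintype.ofFinite _ (Subtype.finite)

noncomputable instance : DecidableEq (ExteriorLine F) := Classical.decEq _

/-! ### Collineation groups -/

variable {F}

/-- The permutation `π` of the points of `PG(2,q)` is induced by a bijective semilinear map of
`F³` with companion automorphism `σ`. -/
def IsInducedBySemilinear (σ : F ≃+* F) (π : Equiv.Perm (ProjPlane F)) : Prop :=
  ∃ f : (Fin 3 → F) ≃+ (Fin 3 → F), (∀ (c : F) (v : Fin 3 → F), f (c • v) = σ c • f v) ∧
    ∀ (v : Fin 3 → F) (hv : v ≠ 0),
      π (Projectivization.mk F v hv) =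
        Projectivization.mk F (f v) ((map_ne_zero_iff f f.injective).mpr hv)

/-- The group of collineations of `PG(2,q)` induced by semilinear maps whose companion
automorphism lies in `S`. It is `PGL(3,q)` for `S = ⊥` and `PΓL(3,q)` for `S = ⊤`. -/
def collineationGroup (S : Subgroup (F ≃+* F)) : Subgroup (Equiv.Perm (ProjPlane F)) where
  carrier := {π | ∃ σ ∈ S, IsInducedBySemilinear σ π}
  one_mem' := ⟨1, S.one_mem, AddEquiv.refl _, fun _ _ => rfl, fun _ _ => rfl⟩
  mul_mem' := by
    rintro π ρ ⟨σ, hσ, f, hf, hf'⟩ ⟨τ, hτ, g, hg, hg'⟩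
    refine ⟨σ * τ, S.mul_mem hσ hτ, g.trans f, fun c v => ?_, fun v hv => ?_⟩
    · simp [hg, hf]
    · simp [hg', hf']
  inv_mem' := by
    rintro π ⟨σ, hσ, f, hf, hf'⟩
    refine ⟨σ⁻¹, S.inv_mem hσ, f.symm, fun c v => ?_, fun v hv => ?_⟩
    · apply f.injective
      rw [hf, AddEquiv.apply_symm_apply, AddEquiv.apply_symm_apply]
      exact congrArg (· • v) (σ.apply_symm_apply c).symm
    · rw [Equiv.Perm.inv_eq_iff_eq, hf']
      simp

/-- The collineations in `collineationGroup S` that fix the conic setwise. -/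
def conicStabilizer (S : Subgroup (F ≃+* F)) : Subgroup (Equiv.Perm (ProjPlane F)) :=
  collineationGroup S ⊓ MulAction.stabilizer (Equiv.Perm (ProjPlane F)) (conic F)

theorem collineation_smul_perpLine {S : Subgroup (F ≃+* F)} {π : Equiv.Perm (ProjPlane F)}
    (hπ : π ∈ collineationGroup S) (w : ProjPlane F) : ∃ w', π • perpLine w = perpLine w' := by
  obtain ⟨σ, -, f, hf, hf'⟩ := hπ
  induction w using Projectivization.ind with | h w hw =>
  have hfs : ∀ (c : F) (v : Fin 3 → F), f.symm (σ c • v) = c • f.symm v := fun c v => by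
    apply f.injective
    rw [hf]
    simp
  let φ : (Fin 3 → F) →ₗ[F] F :=
    { toFun := fun v => σ (f.symm v ⬝ᵥ w)
      map_add' := fun u v => by simp
      map_smul' := fun c v => by
        obtain ⟨c, rfl⟩ := σ.surjective c
        simp [hfs] }
  let w' : Fin 3 → F := fun i => φ (Pi.single i 1)
  have hφ : ∀ v, v ⬝ᵥ w' = σ (f.symm v ⬝ᵥ w) := fun v => by
    change _ = φ v
    rw [LinearMap.pi_apply_eq_sum_univ φ v]
    simp only [dotProduct, w', smul_eq_mul]
    refine Finset.sum_congr rfl fun i _ => ?_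
    congr 2
    ext j
    simp [Pi.single_apply, eq_comm]
  have hw' : w' ≠ 0 := fun h => hw <| by
    refine (dotProduct_eq_zero_iff (v := w)).mp fun v => ?_
    have := hφ (f v)
    rw [h, dotProduct_zero, AddEquiv.symm_apply_apply] at this
    rw [dotProduct_comm]
    exact (map_eq_zero_iff σ σ.injective).mp this.symm
  refine ⟨Projectivization.mk F w' hw', ?_⟩
  ext p
  rw [Set.mem_smul_set_iff_inv_smul_mem]
  obtain ⟨p, rfl⟩ := π.surjective p
  induction p using Projectivization.ind with | h v hv =>
  change π⁻¹ • π • Projectivization.mk F v hv ∈ _ ↔ π • Projectivization.mk F v hv ∈ _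
  rw [inv_smul_smul, Equiv.Perm.smul_def, hf']
  simp only [perpLine, Set.mem_ofPred_eq, Projectivization.orthogonal_mk, hφ,
    AddEquiv.symm_apply_apply, map_eq_zero_iff σ σ.injective]

/-- The action of the stabilizer of the conic on the exterior lines, `π • l = π(l)`. -/
noncomputable instance (S : Subgroup (F ≃+* F)) :
    MulAction (conicStabilizer S) (ExteriorLine F) where
  smul π l := ⟨(π : Equiv.Perm (ProjPlane F)) • l.1, by
    obtain ⟨w, hw⟩ := l.2.1
    rw [hw]
    exact collineation_smul_perpLine π.2.1 w, by
    have h : (π : Equiv.Perm (ProjPlane F)) • conic F = conic F := π.2.2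
    have h' := congrArg ((π : Equiv.Perm (ProjPlane F)) • ·) l.2.2
    simp only [Set.smul_set_inter, h, Set.smul_set_empty] at h'
    exact h'⟩
  one_smul l := Subtype.ext (one_smul (Equiv.Perm (ProjPlane F)) l.1)
  mul_smul π ρ l := Subtype.ext (mul_smul (π : Equiv.Perm (ProjPlane F)) ρ l.1)

variable (F)

/-- `PGL(2,q)`, as the subgroup of `PGL(3,q)` fixing the conic setwise. -/
abbrev PGLTwo : Type _ := conicStabilizer (⊥ : Subgroup (F ≃+* F))

/-- `PΓL(2,q)`, as the subgroup of `PΓL(3,q)` fixing the conic setwise. -/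
abbrev PGammaLTwo : Type _ := conicStabilizer (⊤ : Subgroup (F ≃+* F))

end Plane

/-! ### The elliptic scheme and its Frobenius fusion -/

section Elliptic

variable {F : Type*} [Field F]

/-- For `a ≠ 0`, the relation `Γ_a = {(l, m) | ρ̂(l, m) = a}` on exterior lines, where
`ρ̂((1,x,y)^⊥, (1,z,u)^⊥) = x²u² + y²z² + (x+z)(y+u)`. -/
def ellipticRel (a : F) : Set (ExteriorLine F × ExteriorLine F) :=
  {p | ∃ x y z u : F, p.1.1 = lineOf x y ∧ p.2.1 = lineOf z u ∧
    x ^ 2 * u ^ 2 + y ^ 2 * z ^ 2 + (x + z) * (y + u) = a}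

/-- `C_a = {a, a², a⁴, …}`, the orbit of `a` under the Frobenius automorphism. -/
def frobeniusOrbit (a : F) : Set F := Set.range fun i : ℕ => a ^ 2 ^ i

/-- For `a ≠ 0`, the relation `Δ_a`, the union of the `Γ_i` with `i ∈ C_a`. -/
def fusionRel (a : F) : Set (ExteriorLine F × ExteriorLine F) :=
  ⋃ i ∈ frobeniusOrbit a, ellipticRel i

variable (F) [Algebra (ZMod 2) F]

/-- `T₀*`: the nonzero elements of absolute trace zero. -/
def traceZeroStar : Set F := {a | Algebra.trace (ZMod 2) F a = 0 ∧ a ≠ 0}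

/-- The relations of the elliptic scheme: the diagonal and the `Γ_a`, `a ∈ T₀*`. -/
def ellipticRelations : Set (Set (ExteriorLine F × ExteriorLine F)) :=
  insert (Set.diagonal (ExteriorLine F)) (ellipticRel '' traceZeroStar F)

/-- The relations of the fusion scheme: the diagonal and the `Δ_a`, `a ∈ T₀*`. -/
def fusionRelations : Set (Set (ExteriorLine F × ExteriorLine F)) :=
  insert (Set.diagonal (ExteriorLine F)) (fusionRel '' traceZeroStar F)

end Elliptic

/-!
The exterior lines are the lines `(1,x,y)^⊥` with `x ≠ 0` and `Tr(xy) = 1`, because such a line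
meets the conic where `x ξ² + ξ + y = 0`, and additive Hilbert 90 decides when this is solvable.

*Orbits.* The conic is the zero set of `Q(a) = a₀² + a₁a₂`, and `ρ̂(ℓ, k)` is the value of `Q` at
the cross product of the coordinate vectors of `ℓ` and `k`. A semilinear map preserving the conic
preserves `Q` up to a scalar and its companion automorphism, and fixes the nucleus of the conic;
this pins down its matrix (`exists_smul_lineOf_eq`) and shows that it changes `ρ̂` only by the
automorphism (`rho_smul_smul`). Conversely every pair of distinct lines can be moved by the linear
group to a pair `(1,c,y)^⊥, (1,c,y+1)^⊥` with `c² = ρ̂`, and the remaining freedom in `y` is again killed by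
Hilbert 90 (`exists_smul_eq_smul_eq`). Hence the orbits are the level sets of `ρ̂`, up to the
Frobenius automorphism in the semilinear case.

*Pseudocyclicity of the elliptic scheme.* Each nondiagonal relation has valency `q + 1`, the
number of vectors of given norm in the quadratic extension (`card_filter_rho_eq`), and two
distinct lines are equidistant from exactly `q` lines (`card_filter_rho_eq_rho`). So `∑ A_a²` is a
combination of `I` and `J`, and orthogonality of eigenvalues forces every primitive idempotent
other than `J / |ℰ|` to have rank `q + 1` (`IsPseudocyclicDistance.trace_eq`).

*Fusion.* The Bose-Mesner algebra of the fusion scheme consists of the Frobenius-invariant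
elements of that of the elliptic scheme, so its primitive idempotents are sums over Frobenius
orbits of those of the elliptic scheme. As `m` is prime, the orbits have length `1` or `m`. Length
`1` is impossible for a nontrivial idempotent (`IsFrobeniusPair.submatrix_ne`): as `m` is odd, `1`
has trace one, hence the Frobenius orbits on `𝐓₀*` have length `m`; the eigenvalues on a fixed
idempotent would be algebraic integers constant on these orbits, and their sum `-1` would be
divisible by `m`. So all nontrivial multiplicities of the fusion scheme equal `m (q + 1)`
(`IsFrobeniusPair.rank_eq`).
-/

/-! ### Primitive idempotents of algebras of symmetric matrices -/

section SymmetricMatrices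

variable {X : Type*} [Fintype X] [DecidableEq X]

theorem mul_comm_of_forall_isSymm {B : Subalgebra ℝ (Matrix X X ℝ)} (hB : ∀ M ∈ B, M.IsSymm)
    {M N : Matrix X X ℝ} (hM : M ∈ B) (hN : N ∈ B) : M * N = N * M := by
  have h := hB _ (B.mul_mem hM hN)
  rw [Matrix.IsSymm, Matrix.transpose_mul, hB M hM, hB N hN] at h
  exact h.symm

/-- An algebra of symmetric real matrices is reduced, so it is a semisimple ring and each of its
ideals is generated by an idempotent. -/
theorem exists_idempotent_of_forall_isSymm {B : Subalgebra ℝ (Matrix X X ℝ)}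
    (hB : ∀ M ∈ B, M.IsSymm) {C : Matrix X X ℝ} (hC : C ∈ B) :
    ∃ e ∈ B, e * e = e ∧ (∃ D ∈ B, e = D * C) ∧ C * e = C := by
  let : CommRing B := { B.toRing with
    mul_comm := fun M N => Subtype.ext (mul_comm_of_forall_isSymm hB M.2 N.2) }
  have hred : IsReduced B := by
    rw [isReduced_iff_pow_one_lt 2 one_lt_two]
    rintro ⟨M, hM⟩ h
    have h' : M * M = 0 := by
      have := congrArg Subtype.val h
      rwa [pow_two] at this
    refine Subtype.ext ?_
    have h2 : M * M.conjTranspose = 0 := by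
      rw [Matrix.conjTranspose_eq_transpose_of_trivial, hB M hM, h']
    exact Matrix.self_mul_conjTranspose_eq_zero.mp h2
  have : IsArtinianRing B := IsArtinianRing.of_finite ℝ B
  have := IsArtinianRing.isSemisimpleRing_of_isReduced B
  obtain ⟨e, he, hI⟩ := IsSemisimpleRing.ideal_eq_span_idempotent
    (Ideal.span {(⟨C, hC⟩ : B)})
  have h1 : e ∈ Ideal.span {(⟨C, hC⟩ : B)} := hI ▸ Ideal.mem_span_singleton_self e
  have h2 : (⟨C, hC⟩ : B) ∈ Ideal.span {e} := hI ▸ Ideal.mem_span_singleton_self _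
  obtain ⟨D, hD⟩ := Ideal.mem_span_singleton'.mp h1
  obtain ⟨D', hD'⟩ := Ideal.mem_span_singleton'.mp h2
  refine ⟨e.1, e.2, congrArg Subtype.val he, ⟨D.1, D.2, ?_⟩, ?_⟩
  · exact (congrArg Subtype.val hD).symm
  · have : (⟨C, hC⟩ : B) * e = ⟨C, hC⟩ := by
      rw [← hD', mul_assoc, he.eq]
    exact congrArg Subtype.val this

/-- Every element of an algebra of symmetric matrices acts as a scalar on the range of a primitive
idempotent `E`: an eigenvalue `μ` of `E * A` on that range exists because `E * A` is symmetric, and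
the idempotent generating the ideal of `E * A - μ • E` is then smaller than `E`. -/
theorem IsPrimitiveIdempotent.exists_mul_eq_smul {B : Subalgebra ℝ (Matrix X X ℝ)}
    (hB : ∀ M ∈ B, M.IsSymm) {E A : Matrix X X ℝ} (hE : IsPrimitiveIdempotent B E) (hA : A ∈ B) :
    ∃ μ : ℝ, A * E = μ • E := by
  obtain ⟨hEB, hEE, hE0, hmin⟩ := hE
  have hcomm : A * E = E * A := mul_comm_of_forall_isSymm hB hA hEB
  by_cases h0 : E * A = 0
  · exact ⟨0, by rw [hcomm, h0, zero_smul]⟩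
  have hEA := B.mul_mem hEB hA
  have hherm : (E * A).IsHermitian := by
    rw [Matrix.IsHermitian, Matrix.conjTranspose_eq_transpose_of_trivial]
    exact hB _ hEA
  obtain ⟨v, μ, hμ, hv, hev⟩ := hherm.exists_eigenvector_of_ne_zero h0
  have hEv : E.mulVec v = v := by
    have h1 : E.mulVec ((E * A).mulVec v) = (E * A).mulVec v := by
      rw [Matrix.mulVec_mulVec, ← mul_assoc, hEE]
    rw [hev, Matrix.mulVec_smul] at h1
    exact smul_right_injective _ hμ h1
  have hC : E * A - μ • E ∈ B := B.sub_mem hEA (B.smul_mem hEB μ)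
  obtain ⟨e, heB, hee, ⟨D, -, heD⟩, hCe⟩ := exists_idempotent_of_forall_isSymm hB hC
  have heE : e * E = e := by
    have : (E * A - μ • E) * E = E * A - μ • E := by
      rw [sub_mul, mul_assoc, hcomm, ← mul_assoc, hEE, smul_mul_assoc, hEE]
    rw [heD, mul_assoc, this]
  have hev0 : e.mulVec v = 0 := by
    rw [heD, ← Matrix.mulVec_mulVec, Matrix.sub_mulVec, hev, Matrix.smul_mulVec, hEv, sub_self,
      Matrix.mulVec_zero]
  rcases hmin e heB hee (by rw [mul_comm_of_forall_isSymm hB hEB heB, heE]) heE with h | h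
  · refine ⟨μ, ?_⟩
    rw [h, mul_zero] at hCe
    rw [hcomm]
    exact sub_eq_zero.mp hCe.symm
  · rw [h, hEv] at hev0
    exact absurd hev0 hv

theorem rank_eq_trace_of_mul_self {E : Matrix X X ℝ} (hE : E * E = E) :
    (E.rank : ℝ) = E.trace := by
  have hid : IsIdempotentElem (Matrix.toLin' E) := by
    rw [IsIdempotentElem, Module.End.mul_eq_comp, ← Matrix.toLin'_mul, hE]
  have hproj := LinearMap.IsIdempotentElem.isProj_range _ hid
  have := hproj.trace
  rw [Matrix.trace_toLin'_eq] at this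
  rw [this, Matrix.rank]
  rfl

theorem Matrix.eq_zero_of_rank_eq_zero {M : Matrix X X ℝ} (h : M.rank = 0) : M = 0 := by
  rw [Matrix.rank, Module.finrank_eq_zero_iff_of_free, Submodule.subsingleton_iff_eq_bot,
    LinearMap.range_eq_bot] at h
  exact Matrix.toLin'.injective (h.trans (map_zero _).symm)

/-- Below every nonzero idempotent of a matrix algebra there is a primitive one. -/
theorem exists_isPrimitiveIdempotent_mul_eq {B : Subalgebra ℝ (Matrix X X ℝ)}
    {e : Matrix X X ℝ} (he : e ∈ B) (hee : e * e = e) (he0 : e ≠ 0) :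
    ∃ E, IsPrimitiveIdempotent B E ∧ E * e = E := by
  induction hn : e.rank using Nat.strong_induction_on generalizing e with
  | _ n ih =>
  by_cases hp : IsPrimitiveIdempotent B e
  · exact ⟨e, hp, hee⟩
  have : ∃ f ∈ B, f * f = f ∧ e * f = f ∧ f * e = f ∧ f ≠ 0 ∧ f ≠ e := by
    by_contra hcon
    refine hp ⟨he, hee, he0, fun f hf hff h1 h2 => ?_⟩
    by_contra h3
    rw [not_or] at h3
    exact hcon ⟨f, hf, hff, h1, h2, h3⟩
  obtain ⟨f, hf, hff, h1, h2, hf0, hfe⟩ := this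
  have hd : (e - f) * (e - f) = e - f := by
    rw [sub_mul, mul_sub, mul_sub, hee, hff, h1, h2, sub_self, sub_zero]
  have hr : (e - f).rank + f.rank = e.rank := by
    have : ((e - f).rank : ℝ) + f.rank = e.rank := by
      rw [rank_eq_trace_of_mul_self hd, rank_eq_trace_of_mul_self hff,
        rank_eq_trace_of_mul_self hee, Matrix.trace_sub, sub_add_cancel]
    exact_mod_cast this
  have hpos : (e - f).rank ≠ 0 := fun h =>
    hfe (sub_eq_zero.mp (Matrix.eq_zero_of_rank_eq_zero h)).symm
  obtain ⟨E, hE, hEf⟩ := ih f.rank (by omega) hf hff hf0 rfl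
  exact ⟨E, hE, by rw [← hEf, mul_assoc, h2]⟩

/-- Distinct primitive idempotents are orthogonal. -/
theorem IsPrimitiveIdempotent.mul_eq_zero {B : Subalgebra ℝ (Matrix X X ℝ)}
    (hB : ∀ M ∈ B, M.IsSymm) {E E' : Matrix X X ℝ} (hE : IsPrimitiveIdempotent B E)
    (hE' : IsPrimitiveIdempotent B E') (h : E ≠ E') : E * E' = 0 := by
  have hc : E * E' = E' * E := mul_comm_of_forall_isSymm hB hE.1 hE'.1
  have hid : E * E' * (E * E') = E * E' := by
    rw [mul_assoc, ← mul_assoc E', ← hc, mul_assoc E, hE'.2.1, ← mul_assoc, hE.2.1]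
  have h1 : E * (E * E') = E * E' := by rw [← mul_assoc, hE.2.1]
  have h2 : E * E' * E = E * E' := by rw [mul_assoc, ← hc, h1]
  have h3 : E * E' * E' = E * E' := by rw [mul_assoc, hE'.2.1]
  have h4 : E' * (E * E') = E * E' := by rw [← mul_assoc, ← hc, h3]
  rcases hE.2.2.2 _ (B.mul_mem hE.1 hE'.1) hid h1 h2 with h0 | h5
  · exact h0
  rcases hE'.2.2.2 _ (B.mul_mem hE.1 hE'.1) hid h4 h3 with h0 | h6
  · exact h0
  exact absurd (h5.symm.trans h6) h

/-- A primitive idempotent other than `J / |X|` is annihilated by the all-one matrix `J`. -/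
theorem IsPrimitiveIdempotent.ones_mul_eq_zero {B : Subalgebra ℝ (Matrix X X ℝ)}
    (hB : ∀ M ∈ B, M.IsSymm) (hJ : (Matrix.of fun _ _ => 1) ∈ B) {E : Matrix X X ℝ}
    (hE : IsPrimitiveIdempotent B E) (hne : E ≠ trivialIdempotent X) :
    (Matrix.of fun _ _ => 1) * E = 0 := by
  obtain ⟨μ, hμ⟩ := hE.exists_mul_eq_smul hB hJ
  rcases eq_or_ne μ 0 with rfl | hμ0
  · rw [hμ, zero_smul]
  -- `μ E = J E = E J` is constant along columns and along rows, so `E` is a multiple of `J`.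
  have hcol : ∀ x x' y, E x y = E x' y := fun x x' y => by
    have h1 := congrFun (congrFun hμ x) y
    have h2 := congrFun (congrFun hμ x') y
    simp only [Matrix.mul_apply, Matrix.of_apply, one_mul, Matrix.smul_apply, smul_eq_mul] at h1 h2
    exact mul_left_cancel₀ hμ0 (h1.symm.trans h2)
  have hsymm : ∀ x y, E x y = E y x := fun x y => (hB E hE.1).apply y x
  have hconst : ∀ x y x' y', E x y = E x' y' := fun x y x' y' => by
    rw [hcol x x' y, hsymm x' y, hcol y y' x', hsymm y' x']
  refine absurd ?_ hne
  have hpt : ∃ x y, E x y ≠ 0 := by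
    by_contra hcon
    push Not at hcon
    exact hE.2.2.1 (by ext x y; exact hcon x y)
  obtain ⟨x₀, y₀, h0⟩ := hpt
  have hsq := congrFun (congrFun hE.2.1 x₀) y₀
  rw [Matrix.mul_apply] at hsq
  simp only [fun z => hconst x₀ z x₀ y₀, fun z => hconst z y₀ x₀ y₀, Finset.sum_const,
    Finset.card_univ, nsmul_eq_mul] at hsq
  ext x y
  rw [hconst x y x₀ y₀, trivialIdempotent, Matrix.of_apply]
  rw [← mul_assoc] at hsq
  exact eq_inv_of_mul_eq_one_right (mul_right_cancel₀ h0 (hsq.trans (one_mul _).symm))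

/-- An eigenvalue of a `0-1` matrix is an algebraic integer. -/
theorem isIntegral_of_map_intCast_mul_eq_smul {N : Matrix X X ℤ} {E : Matrix X X ℝ} {μ : ℝ}
    (hE : E ≠ 0) (h : N.map (Int.castRingHom ℝ) * E = μ • E) : IsIntegral ℤ μ := by
  refine ⟨N.charpoly, N.charpoly_monic, ?_⟩
  have hcol : ∃ y, (fun x => E x y) ≠ 0 := by
    by_contra hcon
    push Not at hcon
    exact hE (by ext x y; exact congrFun (hcon y) x)
  obtain ⟨y, hy⟩ := hcol
  have hdet : (Matrix.scalar X μ - N.map (Int.castRingHom ℝ)).det = 0 := by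
    rw [← Matrix.exists_mulVec_eq_zero_iff]
    refine ⟨_, hy, ?_⟩
    ext x
    have := congrFun (congrFun h x) y
    rw [Matrix.mul_apply] at this
    rw [Matrix.sub_mulVec, Pi.sub_apply, Pi.zero_apply, sub_eq_zero]
    rw [Matrix.scalar_apply, Matrix.mulVec_diagonal]
    exact this.symm
  rw [← Matrix.eval_charpoly, Matrix.charpoly_map, Polynomial.eval_map] at hdet
  exact hdet

end SymmetricMatrices

/-! ### Schemes presented by a distance function -/

section Distance

variable {X K : Type*} [Fintype X] [DecidableEq X] [DecidableEq K] [Zero K]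

/-- The relations `{(x, y) | ρ x y = a}`, `a ∈ T`, and the diagonal `ρ = 0` of `X × X` behave like
those of a pseudocyclic scheme with valency `k`: every nondiagonal relation has valency `k`, and
any two distinct points have the same distance to exactly `k - 1` points. -/
structure IsPseudocyclicDistance (ρ : X → X → K) (T : Finset K) (k : ℕ) : Prop where
  symm : ∀ x y, ρ x y = ρ y x
  eq_zero_iff : ∀ x y, ρ x y = 0 ↔ x = y
  mem : ∀ x y, x ≠ y → ρ x y ∈ T
  zero_notMem : 0 ∉ T
  valency : ∀ x, ∀ a ∈ T, (Finset.univ.filter fun y => ρ x y = a).card = k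
  count : ∀ x y, x ≠ y → (Finset.univ.filter fun z => ρ x z = ρ z y).card + 1 = k

/-- The matrix with entries `f (ρ x y)`. -/
def distMatrix (ρ : X → X → K) (f : K → ℝ) : Matrix X X ℝ := Matrix.of fun x y => f (ρ x y)

/-- The adjacency matrix of the relation `ρ x y = a`. -/
def distAdj (ρ : X → X → K) (a : K) : Matrix X X ℝ := distMatrix ρ fun b => if b = a then 1 else 0

namespace IsPseudocyclicDistance

variable {ρ : X → X → K} {T : Finset K} {k : ℕ} (h : IsPseudocyclicDistance ρ T k)

include h

theorem isSymm_distMatrix (f : K → ℝ) : (distMatrix ρ f).IsSymm := by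
  ext x y
  rw [Matrix.transpose_apply, distMatrix, Matrix.of_apply, Matrix.of_apply, h.symm]

theorem sum_comp (x : X) (g : K → ℝ) : ∑ y, g (ρ x y) = g 0 + k * ∑ a ∈ T, g a := by
  have hmaps : ∀ y ∈ (Finset.univ : Finset X), ρ x y ∈ insert 0 T := fun y _ => by
    rw [Finset.mem_insert, h.eq_zero_iff]
    exact (em (x = y)).imp_right (h.mem x y)
  rw [← Finset.sum_fiberwise_of_maps_to hmaps, Finset.sum_insert h.zero_notMem, Finset.mul_sum]
  congr 1
  · have : (Finset.univ.filter fun y => ρ x y = 0) = {x} := by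
      ext y
      simp [h.eq_zero_iff, eq_comm]
    rw [this, Finset.sum_singleton, (h.eq_zero_iff x x).mpr rfl]
  · refine Finset.sum_congr rfl fun a ha => ?_
    rw [Finset.sum_congr rfl (g := fun _ => g a) fun y hy => by rw [(Finset.mem_filter.mp hy).2],
      Finset.sum_const, h.valency x a ha, nsmul_eq_mul]

theorem card_eq [Nonempty X] : (Fintype.card X : ℝ) = 1 + k * T.card := by
  obtain ⟨x⟩ := ‹Nonempty X›
  simpa using h.sum_comp x fun _ => 1

theorem sum_distAdj : ∑ a ∈ T, distAdj ρ a = (Matrix.of fun _ _ => 1) - 1 := by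
  ext x y
  rw [Matrix.sum_apply, Matrix.sub_apply, Matrix.of_apply]
  simp only [distAdj, distMatrix, Matrix.of_apply, Finset.sum_ite_eq]
  by_cases hxy : x = y
  · rw [hxy, (h.eq_zero_iff y y).mpr rfl, if_neg h.zero_notMem, Matrix.one_apply_eq, sub_self]
  · rw [if_pos (h.mem x y hxy), Matrix.one_apply_ne hxy, sub_zero]

theorem sum_distAdj_mul_self [Nonempty X] : ∑ a ∈ T, distAdj ρ a * distAdj ρ a =
    ((Fintype.card X : ℝ) - k) • (1 : Matrix X X ℝ) +
      ((k : ℝ) - 1) • (Matrix.of fun _ _ => 1) := by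
  ext x y
  have key : (∑ a ∈ T, distAdj ρ a * distAdj ρ a) x y =
      ∑ z, if ρ x z = ρ z y ∧ ρ x z ∈ T then (1 : ℝ) else 0 := by
    simp only [Matrix.sum_apply, Matrix.mul_apply, distAdj, distMatrix, Matrix.of_apply]
    rw [Finset.sum_comm]
    refine Finset.sum_congr rfl fun z _ => ?_
    simp only [ite_mul, one_mul, zero_mul, Finset.sum_ite_eq]
    by_cases hz : ρ x z ∈ T <;> simp [hz, eq_comm]
  rw [key, Matrix.add_apply, Matrix.smul_apply, Matrix.smul_apply, Matrix.of_apply, smul_eq_mul,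
    smul_eq_mul, mul_one]
  by_cases hxy : x = y
  · subst hxy
    have : (∑ z, if ρ x z = ρ z x ∧ ρ x z ∈ T then (1 : ℝ) else 0) =
        ∑ z, (fun a => if a ∈ T then (1 : ℝ) else 0) (ρ x z) :=
      Finset.sum_congr rfl fun z _ => by simp [h.symm x z]
    rw [this, (h.sum_comp x fun a => if a ∈ T then (1 : ℝ) else 0), h.card_eq,
      Matrix.one_apply_eq]
    simp [h.zero_notMem]
  · have : ∀ z, (ρ x z = ρ z y ∧ ρ x z ∈ T) ↔ ρ x z = ρ z y := fun z => by
      refine and_iff_left_of_imp fun hz => h.mem x z fun hxz => hxy ?_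
      rw [← hxz, (h.eq_zero_iff x x).mpr rfl, eq_comm, h.eq_zero_iff] at hz
      exact hz
    simp only [this, Finset.sum_boole]
    rw [Matrix.one_apply_ne hxy, mul_zero, zero_add, ← h.count x y hxy]
    simp

theorem isSymm_of_mem {B : Subalgebra ℝ (Matrix X X ℝ)} (hB : ∀ M ∈ B, ∃ f, M = distMatrix ρ f) :
    ∀ M ∈ B, M.IsSymm := fun M hM => by
  obtain ⟨f, rfl⟩ := hB M hM
  exact h.isSymm_distMatrix f

/-- The multiplicities of a pseudocyclic scheme: if `t` is the rank of `E` and `μ a` the eigenvalue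
of the relation `a` on it, orthogonality gives `n * k = t * (k + ∑ (μ a)²)`, whereas the common
equidistance count says `∑ (μ a)² = n - k`. -/
theorem trace_eq [Nonempty X] {B : Subalgebra ℝ (Matrix X X ℝ)}
    (hB : ∀ M, M ∈ B ↔ ∃ f, M = distMatrix ρ f) {E : Matrix X X ℝ}
    (hE : IsPrimitiveIdempotent B E) (hJE : (Matrix.of fun _ _ => 1) * E = 0) :
    E.trace = k := by
  have hsymm := h.isSymm_of_mem fun M hM => (hB M).mp hM
  have hA : ∀ a, ∃ μ : ℝ, distAdj ρ a * E = μ • E := fun a =>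
    hE.exists_mul_eq_smul hsymm ((hB _).mpr ⟨_, rfl⟩)
  choose μ hμ using hA
  obtain ⟨f, hf⟩ := (hB E).mp hE.1
  have hn : (0 : ℝ) < Fintype.card X := by exact_mod_cast Fintype.card_pos
  have hsq : ∑ a ∈ T, μ a ^ 2 = Fintype.card X - k := by
    have h1 : (∑ a ∈ T, distAdj ρ a * distAdj ρ a) * E = (∑ a ∈ T, μ a ^ 2) • E := by
      rw [Finset.sum_mul, Finset.sum_smul]
      refine Finset.sum_congr rfl fun a _ => ?_
      rw [mul_assoc, hμ, mul_smul_comm, hμ, smul_smul, pow_two]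
    rw [h.sum_distAdj_mul_self, add_mul, smul_mul_assoc, smul_mul_assoc, hJE, smul_zero, add_zero,
      one_mul] at h1
    exact (smul_left_injective ℝ hE.2.2.1 h1).symm
  have htr0 : E.trace = Fintype.card X * f 0 := by
    rw [hf]
    simp [Matrix.trace, distMatrix, (h.eq_zero_iff _ _).mpr rfl]
  have htr : ∀ a ∈ T, μ a * E.trace = Fintype.card X * (k * f a) := fun a ha => by
    have h1 := congrArg Matrix.trace (hμ a)
    rw [Matrix.trace_smul, smul_eq_mul] at h1
    rw [← h1, hf, Matrix.trace]
    have : ∀ x, (distAdj ρ a * distMatrix ρ f).diag x = k * f a := fun x => by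
      rw [Matrix.diag_apply, Matrix.mul_apply]
      have : ∀ y, distAdj ρ a x y * distMatrix ρ f y x =
          (fun b => (if b = a then 1 else 0) * f b) (ρ x y) := fun y => by
        simp only [distAdj, distMatrix, Matrix.of_apply, h.symm y x]
      rw [Finset.sum_congr rfl fun y _ => this y,
        (h.sum_comp x fun b => (if b = a then 1 else 0) * f b)]
      have h0 : (0 : K) ≠ a := fun h0 => h.zero_notMem (h0 ▸ ha)
      simp [h0, ha]
    rw [Finset.sum_congr rfl fun x _ => this x, Finset.sum_const, Finset.card_univ, nsmul_eq_mul]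
  have htr2 : E.trace = Fintype.card X * (f 0 ^ 2 + k * ∑ a ∈ T, f a ^ 2) := by
    conv_lhs => rw [← hE.2.1]
    rw [Matrix.trace]
    have : ∀ x, (E * E).diag x = f 0 ^ 2 + k * ∑ a ∈ T, f a ^ 2 := fun x => by
      rw [Matrix.diag_apply, Matrix.mul_apply, ← h.sum_comp x fun a => f a ^ 2]
      refine Finset.sum_congr rfl fun y _ => ?_
      rw [hf, distMatrix, Matrix.of_apply, Matrix.of_apply, h.symm y x, pow_two]
    rw [Finset.sum_congr rfl fun x _ => this x, Finset.sum_const, Finset.card_univ, nsmul_eq_mul]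
  have htpos : E.trace ≠ 0 := fun h0 => by
    rw [← rank_eq_trace_of_mul_self hE.2.1, Nat.cast_eq_zero] at h0
    exact hE.2.2.1 (Matrix.eq_zero_of_rank_eq_zero h0)
  -- `n k t = t² (k + ∑ (μ a)²)`
  have hmain : Fintype.card X * k * E.trace = E.trace ^ 2 * (k + ∑ a ∈ T, μ a ^ 2) := by
    have h1 : E.trace ^ 2 * ∑ a ∈ T, μ a ^ 2 =
        (Fintype.card X * k) ^ 2 * ∑ a ∈ T, f a ^ 2 := by
      rw [Finset.mul_sum, Finset.mul_sum]
      refine Finset.sum_congr rfl fun a ha => ?_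
      linear_combination (μ a * E.trace + Fintype.card X * (k * f a)) * htr a ha
    rw [mul_add, h1]
    linear_combination (Fintype.card X * k : ℝ) * htr2 -
      k * (E.trace + Fintype.card X * f 0) * htr0
  rw [hsq] at hmain
  have : (Fintype.card X * E.trace) * (E.trace - k) = 0 := by linear_combination -hmain
  rcases mul_eq_zero.mp this with h0 | h0
  · exact absurd h0 (mul_ne_zero hn.ne' htpos)
  · exact sub_eq_zero.mp h0

end IsPseudocyclicDistance

end Distance

/-! ### Fusion under an automorphism of prime order -/

section Fusion

variable {X K : Type*} [Fintype X] [DecidableEq X] [DecidableEq K] [Zero K]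

theorem submatrix_iterate_mul (τ : Equiv.Perm X) (i : ℕ) (M N : Matrix X X ℝ) :
    (fun M : Matrix X X ℝ => M.submatrix τ τ)^[i] (M * N) =
      (fun M : Matrix X X ℝ => M.submatrix τ τ)^[i] M *
        (fun M : Matrix X X ℝ => M.submatrix τ τ)^[i] N := by
  induction i generalizing M N with
  | zero => rfl
  | succ i ih =>
    rw [Function.iterate_succ_apply, Function.iterate_succ_apply, Function.iterate_succ_apply, ← ih,
      Matrix.submatrix_mul_equiv]

theorem trace_submatrix_iterate (τ : Equiv.Perm X) (i : ℕ) (M : Matrix X X ℝ) :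
    ((fun M : Matrix X X ℝ => M.submatrix τ τ)^[i] M).trace = M.trace := by
  induction i generalizing M with
  | zero => rfl
  | succ i ih =>
    rw [Function.iterate_succ_apply, ih]
    exact Equiv.sum_comp τ fun x => M x x

/-- `ρ` is equivariant for the permutation `τ` of the points and the map `σ` of the distances,
which has prime order `m` and moves each distance in `T`. -/
structure IsFrobeniusPair (ρ : X → X → K) (T : Finset K) (m : ℕ) (τ : Equiv.Perm X) (σ : K → K) :
    Prop where
  equivariant : ∀ x y, ρ (τ x) (τ y) = σ (ρ x y)
  iterate_eq : ∀ a, σ^[m] a = a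
  mapsTo : ∀ a ∈ T, σ a ∈ T
  ne : ∀ a ∈ T, σ a ≠ a

namespace IsFrobeniusPair

variable {ρ : X → X → K} {T : Finset K} {k m : ℕ} {τ : Equiv.Perm X} {σ : K → K}
  (hF : IsFrobeniusPair ρ T m τ σ)

include hF

theorem submatrix_distMatrix (f : K → ℝ) :
    (distMatrix ρ f).submatrix τ τ = distMatrix ρ (f ∘ σ) := by
  ext x y
  simp only [Matrix.submatrix_apply, distMatrix, Matrix.of_apply, hF.equivariant,
    Function.comp_apply]

theorem submatrix_iterate_distMatrix (i : ℕ) (f : K → ℝ) :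
    (fun M : Matrix X X ℝ => M.submatrix τ τ)^[i] (distMatrix ρ f) =
      distMatrix ρ (f ∘ σ^[i]) := by
  induction i generalizing f with
  | zero => rfl
  | succ i ih =>
    rw [Function.iterate_succ_apply, hF.submatrix_distMatrix, ih, Function.comp_assoc,
      ← Function.iterate_succ']

theorem submatrix_iterate_prime (f : K → ℝ) :
    (fun M : Matrix X X ℝ => M.submatrix τ τ)^[m] (distMatrix ρ f) = distMatrix ρ f := by
  rw [hF.submatrix_iterate_distMatrix, show f ∘ σ^[m] = f from
    funext fun a => congrArg f (hF.iterate_eq a)]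

theorem injective (hm : m ≠ 0) : Function.Injective σ := fun a b hab => by
  obtain ⟨m, rfl⟩ := Nat.exists_eq_succ_of_ne_zero hm
  rw [← hF.iterate_eq a, ← hF.iterate_eq b, Function.iterate_succ_apply,
    Function.iterate_succ_apply, hab]

/-- A `σ`-invariant function on `T` takes each value a multiple of `m` times. -/
theorem dvd_card_filter [hm : Fact m.Prime] (μ : K → ℝ) (hμ : ∀ a ∈ T, μ (σ a) = μ a) (b : ℝ) :
    m ∣ (T.filter fun a => μ a = b).card := by
  have hmap : ∀ a, a ∈ T.filter (fun a => μ a = b) → σ a ∈ T.filter (fun a => μ a = b) :=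
    fun a ha => by
      rw [Finset.mem_filter] at ha ⊢
      exact ⟨hF.mapsTo a ha.1, (hμ a ha.1).trans ha.2⟩
  let f : Function.End (T.filter fun a => μ a = b) := fun a => ⟨σ a, hmap a a.2⟩
  have hval : ∀ (i : ℕ) (a), ((f ^ i) a : K) = σ^[i] a := fun i => by
    induction i with
    | zero => exact fun a => rfl
    | succ i ih =>
      intro a
      rw [pow_succ, Function.iterate_succ_apply]
      exact ih (f a)
  have hpow : f ^ m ^ 1 = 1 := by
    rw [pow_one]
    funext a
    exact Subtype.ext ((hval m a).trans (hF.iterate_eq a))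
  have hcard := Equiv.Perm.card_fixedPoints_modEq hpow
  have hempty : IsEmpty (Function.fixedPoints f) := ⟨fun a =>
    hF.ne _ (Finset.mem_filter.mp a.1.2).1 (congrArg Subtype.val a.2)⟩
  rw [Fintype.card_coe, Fintype.card_eq_zero] at hcard
  exact (Nat.modEq_zero_iff_dvd).mp hcard

/-- If `τ` fixed `E`, then the eigenvalues `μ a` of the relations on `E`, which are algebraic
integers, would be constant on the orbits of `σ`, and `-1 = ∑ μ a` would be divisible by `m`. -/
theorem submatrix_ne [hm : Fact m.Prime] (h : IsPseudocyclicDistance ρ T k)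
    {B : Subalgebra ℝ (Matrix X X ℝ)}
    (hB : ∀ M, M ∈ B ↔ ∃ f, M = distMatrix ρ f) {E : Matrix X X ℝ}
    (hE : IsPrimitiveIdempotent B E) (hJE : (Matrix.of fun _ _ => 1) * E = 0) :
    E.submatrix τ τ ≠ E := fun hfix => by
  have hsymm := h.isSymm_of_mem fun M hM => (hB M).mp hM
  have hA : ∀ a, ∃ μ : ℝ, distAdj ρ a * E = μ • E := fun a =>
    hE.exists_mul_eq_smul hsymm ((hB _).mpr ⟨_, rfl⟩)
  choose μ hμ using hA
  have hint : ∀ a, IsIntegral ℤ (μ a) := fun a => by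
    refine isIntegral_of_map_intCast_mul_eq_smul (N := Matrix.of fun x y =>
      if ρ x y = a then 1 else 0) hE.2.2.1 ?_
    rw [← hμ a]
    congr 1
    ext x y
    simp [distAdj, distMatrix, apply_ite]
  have hinv : ∀ a, μ (σ a) = μ a := fun a => by
    have h1 : (distAdj ρ (σ a)).submatrix τ τ = distAdj ρ a := by
      rw [distAdj, hF.submatrix_distMatrix, distAdj]
      congr 1
      funext b
      simp [(hF.injective hm.out.ne_zero).eq_iff]
    have h2 : (distAdj ρ (σ a) * E).submatrix τ τ = (μ (σ a) • E).submatrix τ τ := by rw [hμ]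
    rw [← Matrix.submatrix_mul_equiv _ _ τ τ τ, h1, Matrix.submatrix_smul, Pi.smul_apply,
      Pi.smul_apply, hfix, hμ] at h2
    exact (smul_left_injective ℝ hE.2.2.1 h2).symm
  have hsum : ∑ a ∈ T, μ a = -1 := by
    have h1 : (∑ a ∈ T, distAdj ρ a) * E = (∑ a ∈ T, μ a) • E := by
      rw [Finset.sum_mul, Finset.sum_smul]
      exact Finset.sum_congr rfl fun a _ => hμ a
    rw [h.sum_distAdj, sub_mul, hJE, one_mul, zero_sub, ← neg_one_smul ℝ] at h1
    exact (smul_left_injective ℝ hE.2.2.1 h1).symm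
  choose c hc using hF.dvd_card_filter μ fun a _ => hinv a
  have hfib : ∑ a ∈ T, μ a = m * ∑ b ∈ T.image μ, (c b : ℝ) * b := by
    rw [Finset.mul_sum, Finset.sum_comp (fun b : ℝ => b) μ]
    refine Finset.sum_congr rfl fun b _ => ?_
    rw [hc b, nsmul_eq_mul, Nat.cast_mul, mul_assoc]
  have hyint : IsIntegral ℤ (∑ b ∈ T.image μ, (c b : ℝ) * b) := by
    refine IsIntegral.sum _ fun b hb => ?_
    obtain ⟨a, -, rfl⟩ := Finset.mem_image.mp hb
    exact IsIntegral.mul (isIntegral_natCast _) (hint a)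
  have hy : (∑ b ∈ T.image μ, (c b : ℝ) * b) = algebraMap ℚ ℝ (-1 / m) := by
    have hm0 : (m : ℝ) ≠ 0 := by exact_mod_cast hm.out.ne_zero
    rw [hsum] at hfib
    push_cast [eq_ratCast]
    field_simp
    linarith
  rw [hy, isIntegral_algebraMap_iff (algebraMap ℚ ℝ).injective,
    IsIntegrallyClosed.isIntegral_iff] at hyint
  obtain ⟨z, hz⟩ := hyint
  have hm0 : (m : ℚ) ≠ 0 := by exact_mod_cast hm.out.ne_zero
  have hz' : (z * m : ℚ) = -1 := by
    rw [eq_intCast] at hz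
    rw [hz, div_mul_cancel₀ _ hm0]
  have hz'' : z * m = -1 := by exact_mod_cast hz'
  have hdvd : (m : ℤ) ∣ 1 := ⟨-z, by linarith⟩
  exact hm.out.one_lt.ne' (by exact_mod_cast Int.eq_one_of_dvd_one (by positivity) hdvd)

theorem isPrimitiveIdempotent_submatrix (hm : m ≠ 0) {B : Subalgebra ℝ (Matrix X X ℝ)}
    (hB : ∀ M, M ∈ B ↔ ∃ f, M = distMatrix ρ f) {E : Matrix X X ℝ}
    (hE : IsPrimitiveIdempotent B E) : IsPrimitiveIdempotent B (E.submatrix τ τ) := by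
  obtain ⟨m, rfl⟩ := Nat.exists_eq_succ_of_ne_zero hm
  have hmem : ∀ i, ∀ M ∈ B, (fun M : Matrix X X ℝ => M.submatrix τ τ)^[i] M ∈ B := fun i M hM => by
    obtain ⟨f, rfl⟩ := (hB M).mp hM
    rw [hF.submatrix_iterate_distMatrix]
    exact (hB _).mpr ⟨_, rfl⟩
  have hper : ∀ M ∈ B, (fun M : Matrix X X ℝ => M.submatrix τ τ)^[m + 1] M = M := fun M hM => by
    obtain ⟨f, rfl⟩ := (hB M).mp hM
    exact hF.submatrix_iterate_prime f
  have hback : ∀ M ∈ B, (fun M : Matrix X X ℝ => M.submatrix τ τ)^[m] (M.submatrix τ τ) = M :=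
    fun M hM => hper M hM
  have hforth : ∀ M ∈ B,
      ((fun M : Matrix X X ℝ => M.submatrix τ τ)^[m] M).submatrix τ τ = M := fun M hM => by
    have := hper M hM
    rwa [Function.iterate_succ_apply'] at this
  refine ⟨hmem 1 E hE.1, ?_, fun h0 => hE.2.2.1 ?_, fun f hf hff h1 h2 => ?_⟩
  · rw [Matrix.submatrix_mul_equiv, hE.2.1]
  · ext x y
    have := congrFun (congrFun h0 (τ.symm x)) (τ.symm y)
    rwa [Matrix.submatrix_apply, Equiv.apply_symm_apply, Equiv.apply_symm_apply] at this
  · rcases hE.2.2.2 _ (hmem m f hf) (by rw [← submatrix_iterate_mul, hff])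
      (by rw [← hback E hE.1, ← submatrix_iterate_mul, h1])
      (by rw [← hback E hE.1, ← submatrix_iterate_mul, h2]) with h3 | h3
    · left
      rw [← hforth f hf, h3]
      rfl
    · right
      rw [← hforth f hf, h3]

/-- The primitive idempotents of the fusion scheme, other than `J / |X|`, are the sums over the
orbits of `τ` of the primitive idempotents of the original scheme; each such orbit has `m` elements,
and each of its elements has rank `k`. -/
theorem rank_eq [hm : Fact m.Prime] [Nonempty X] (h : IsPseudocyclicDistance ρ T k)
    {B B' : Subalgebra ℝ (Matrix X X ℝ)} (hB : ∀ M, M ∈ B ↔ ∃ f, M = distMatrix ρ f)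
    (hB' : ∀ M, M ∈ B' ↔ ∃ f, (∀ a, f (σ a) = f a) ∧ M = distMatrix ρ f)
    {E' : Matrix X X ℝ} (hE' : IsPrimitiveIdempotent B' E') (hne : E' ≠ trivialIdempotent X) :
    E'.rank = m * k := by
  have hle : ∀ M ∈ B', M ∈ B := fun M hM => by
    obtain ⟨f, -, hf⟩ := (hB' M).mp hM
    exact (hB M).mpr ⟨f, hf⟩
  have hsymm := h.isSymm_of_mem fun M hM => (hB M).mp hM
  have hsymm' : ∀ M ∈ B', M.IsSymm := fun M hM => hsymm M (hle M hM)
  have hJ' : (Matrix.of fun _ _ => (1 : ℝ)) ∈ B' := (hB' _).mpr ⟨fun _ => 1, fun _ => rfl, rfl⟩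
  have hJE' := hE'.ones_mul_eq_zero hsymm' hJ' hne
  have hE'B := hle E' hE'.1
  obtain ⟨E, hE, hEE'⟩ := exists_isPrimitiveIdempotent_mul_eq hE'B hE'.2.1 hE'.2.2.1
  have hE'E : E' * E = E := by rw [mul_comm_of_forall_isSymm hsymm hE'B hE.1, hEE']
  have hJE : (Matrix.of fun _ _ => (1 : ℝ)) * E = 0 := by
    rw [← hE'E, ← mul_assoc, hJE', zero_mul]
  set φ : Matrix X X ℝ → Matrix X X ℝ := fun M => M.submatrix τ τ with hφ
  obtain ⟨f, hf⟩ := (hB E).mp hE.1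
  have hprim : ∀ i, IsPrimitiveIdempotent B (φ^[i] E) := fun i => by
    induction i with
    | zero => exact hE
    | succ i ih =>
      rw [Function.iterate_succ_apply']
      exact hF.isPrimitiveIdempotent_submatrix hm.out.ne_zero hB ih
  have hperiod : Function.minimalPeriod φ E = m := by
    refine Function.minimalPeriod_eq_prime ?_ (hF.submatrix_ne h hB hE hJE)
    rw [Function.IsPeriodicPt, Function.IsFixedPt, hf]
    exact hF.submatrix_iterate_prime f
  have horth : ∀ i ∈ Finset.range m, ∀ j ∈ Finset.range m,
      φ^[i] E * φ^[j] E = if i = j then φ^[i] E else 0 := fun i hi j hj => by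
    split_ifs with hij
    · rw [← hij, (hprim i).2.1]
    · refine (hprim i).mul_eq_zero hsymm (hprim j) fun heq => hij ?_
      refine Function.iterate_injOn_Iio_minimalPeriod (f := φ) (x := E) ?_ ?_ heq
      · rw [hperiod]; exact Finset.mem_range.mp hi
      · rw [hperiod]; exact Finset.mem_range.mp hj
  have hfix : ∀ i, φ^[i] E' = E' := fun i => by
    obtain ⟨g, hg, hgE⟩ := (hB' E').mp hE'.1
    refine Function.iterate_fixed ?_ i
    rw [hgE, hφ]
    exact (hF.submatrix_distMatrix g).trans (congrArg _ (funext hg))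
  set S := ∑ i ∈ Finset.range m, φ^[i] E with hS
  have hSS : S * S = S := by
    rw [hS, Finset.sum_mul_sum]
    refine Finset.sum_congr rfl fun i hi => ?_
    rw [Finset.sum_congr rfl fun j hj => horth i hi j hj, Finset.sum_ite_eq, if_pos hi]
  have hSE' : S * E' = S := by
    rw [hS, Finset.sum_mul]
    refine Finset.sum_congr rfl fun i _ => ?_
    conv_lhs => rw [← hfix i]
    rw [← submatrix_iterate_mul, hEE']
  have hSB' : S ∈ B' := by
    refine (hB' S).mpr ⟨fun a => ∑ i ∈ Finset.range m, f (σ^[i] a), fun a => ?_, ?_⟩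
    · have h1 := Finset.sum_range_succ (fun i => f (σ^[i] a)) m
      have h2 := Finset.sum_range_succ' (fun i => f (σ^[i] a)) m
      rw [h1, hF.iterate_eq] at h2
      exact (add_right_cancel h2).symm
    · rw [hS, hf]
      ext x y
      rw [Matrix.sum_apply]
      change _ = ∑ i ∈ Finset.range m, f (σ^[i] (ρ x y))
      refine Finset.sum_congr rfl fun i _ => ?_
      rw [hφ, hF.submatrix_iterate_distMatrix]
      rfl
  have htrace : S.trace = m * k := by
    rw [hS, Matrix.trace_sum, Finset.sum_congr rfl fun i _ => trace_submatrix_iterate τ i E,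
      h.trace_eq hB hE hJE, Finset.sum_const, Finset.card_range, nsmul_eq_mul]
  have hEtrace := h.trace_eq hB hE hJE
  have hk : (k : ℝ) ≠ 0 := fun h0 => hE.2.2.1 (Matrix.eq_zero_of_rank_eq_zero (by
    rw [h0, ← rank_eq_trace_of_mul_self hE.2.1] at hEtrace
    exact_mod_cast hEtrace))
  have hS0 : S ≠ 0 := fun h0 => by
    rw [h0, Matrix.trace_zero] at htrace
    exact mul_ne_zero (by exact_mod_cast hm.out.ne_zero) hk htrace.symm
  have hSeq : S = E' := (hE'.2.2.2 S hSB' hSS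
    (by rw [mul_comm_of_forall_isSymm hsymm' hE'.1 hSB', hSE']) hSE').resolve_left hS0
  have : (E'.rank : ℝ) = m * k := by rw [rank_eq_trace_of_mul_self hE'.2.1, ← hSeq, htrace]
  exact_mod_cast this

end IsFrobeniusPair

end Fusion

/-! ### The absolute trace in characteristic two -/

section Trace

variable {F : Type*} [Field F] [Algebra (ZMod 2) F]

theorem charP_two_of_algebra (F : Type*) [Field F] [Algebra (ZMod 2) F] : CharP F 2 :=
  charP_of_injective_algebraMap (algebraMap (ZMod 2) F).injective 2

theorem ZMod.eq_zero_or_eq_one (a : ZMod 2) : a = 0 ∨ a = 1 := by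
  revert a; decide

variable [Finite F]

theorem trace_sq (a : F) : Algebra.trace (ZMod 2) F (a ^ 2) = Algebra.trace (ZMod 2) F a := by
  have h := Algebra.trace_eq_of_algEquiv
    (FiniteField.frobeniusAlgEquivOfAlgebraic (ZMod 2) F) a
  rw [FiniteField.coe_frobeniusAlgEquivOfAlgebraic, ZMod.card] at h
  exact h

theorem trace_sq_add_self (a : F) : Algebra.trace (ZMod 2) F (a ^ 2 + a) = 0 := by
  rw [map_add, trace_sq, CharTwo.add_self_eq_zero]

/-- The additive form of Hilbert's Theorem 90 over the field with two elements. -/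
theorem exists_sq_add_self_eq {a : F} (ha : Algebra.trace (ZMod 2) F a = 0) :
    ∃ s : F, s ^ 2 + s = a := by
  have := charP_two_of_algebra F
  let f : F →ₗ[ZMod 2] F :=
    (FiniteField.frobeniusAlgEquivOfAlgebraic (ZMod 2) F).toLinearMap + LinearMap.id
  have hf : ∀ s, f s = s ^ 2 + s := fun s => by
    simp [f, ZMod.card]
  have hker : LinearMap.ker f = Submodule.span (ZMod 2) {1} := by
    ext s
    rw [LinearMap.mem_ker, hf, Submodule.mem_span_singleton]
    constructor
    · intro h
      have h' : s * (s + 1) = 0 := by linear_combination h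
      rcases mul_eq_zero.mp h' with h0 | h1
      · exact ⟨0, by rw [zero_smul, h0]⟩
      · exact ⟨1, by rw [one_smul]; exact (CharTwo.add_eq_zero.mp h1).symm⟩
    · rintro ⟨c, rfl⟩
      rcases ZMod.eq_zero_or_eq_one c with rfl | rfl
      · simp
      · rw [one_smul, one_pow, CharTwo.add_self_eq_zero]
  have h1 := LinearMap.finrank_range_add_finrank_ker f
  have h2 := LinearMap.finrank_range_add_finrank_ker (Algebra.trace (ZMod 2) F)
  rw [hker, finrank_span_singleton one_ne_zero] at h1
  rw [LinearMap.range_eq_top.mpr (Algebra.trace_surjective (ZMod 2) F), finrank_top,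
    Module.finrank_self] at h2
  have hle : LinearMap.range f ≤ LinearMap.ker (Algebra.trace (ZMod 2) F) := by
    rintro _ ⟨s, rfl⟩
    rw [LinearMap.mem_ker, hf, trace_sq_add_self]
  have heq := Submodule.eq_of_le_of_finrank_eq hle (by omega)
  have : a ∈ LinearMap.range f := heq ▸ ha
  obtain ⟨s, hs⟩ := this
  exact ⟨s, (hf s).symm.trans hs⟩

theorem exists_sq_eq (a : F) : ∃ b : F, b ^ 2 = a := by
  have := charP_two_of_algebra F
  exact (PerfectRing.bijective_frobenius (R := F) (p := 2)).2 a

theorem two_mul_card_filter_eq_one {A : Type*} [AddCommGroup A] [Fintype A] (g : A →+ ZMod 2)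
    (hg : ∃ a, g a ≠ 0) : 2 * (Finset.univ.filter fun a => g a = 1).card = Fintype.card A := by
  obtain ⟨b, hb⟩ := hg
  have hb1 := (ZMod.eq_zero_or_eq_one (g b)).resolve_left hb
  have h1 : (Finset.univ.filter fun a => g a = 1).card =
      (Finset.univ.filter fun a => ¬ g a = 1).card := by
    refine Finset.card_bij' (fun a _ => a + b) (fun a _ => a - b) ?_ ?_ ?_ ?_
    · intro a ha
      rw [Finset.mem_filter] at ha ⊢
      refine ⟨Finset.mem_univ _, ?_⟩
      rw [map_add, ha.2, hb1]
      decide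
    · intro a ha
      rw [Finset.mem_filter] at ha ⊢
      refine ⟨Finset.mem_univ _, ?_⟩
      rw [map_sub, hb1, (ZMod.eq_zero_or_eq_one (g a)).resolve_right ha.2]
      decide
    · intro a _
      exact add_sub_cancel_right a b
    · intro a _
      exact sub_add_cancel a b
  have h2 := Finset.card_filter_add_card_filter_not (s := (Finset.univ : Finset A))
    (fun a => g a = 1)
  rw [Finset.card_univ] at h2
  omega

theorem exists_trace_mul_eq_one {a : F} (ha : a ≠ 0) :
    ∃ b, Algebra.trace (ZMod 2) F (a * b) = 1 := by
  obtain ⟨c, hc⟩ := Algebra.trace_surjective (ZMod 2) F 1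
  exact ⟨c / a, by rw [mul_div_cancel₀ _ ha, hc]⟩

end Trace

/-! ### Coordinates of exterior lines -/

section Coordinates

variable {F : Type*} [Field F]

theorem mk_mem_lineOf {v : Fin 3 → F} (hv : v ≠ 0) (x y : F) :
    Projectivization.mk F v hv ∈ lineOf x y ↔ v 0 + v 1 * x + v 2 * y = 0 := by
  change (Projectivization.mk F v hv).orthogonal (Projectivization.mk F ![1, x, y] _) ↔ _
  rw [Projectivization.orthogonal_mk]
  simp [dotProduct, Fin.sum_univ_three]

/-- The quadratic form whose zeros are the points of the conic. -/
def conicForm (v : Fin 3 → F) : F := v 0 ^ 2 + v 1 * v 2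

/-- The function `ρ̂` on the lines `(1,x,y)^⊥` and `(1,z,u)^⊥`. -/
def rhoHat (x y z u : F) : F := x ^ 2 * u ^ 2 + y ^ 2 * z ^ 2 + (x + z) * (y + u)

variable [Algebra (ZMod 2) F]

theorem mk_mem_conic {v : Fin 3 → F} (hv : v ≠ 0) :
    Projectivization.mk F v hv ∈ conic F ↔ conicForm v = 0 := by
  have := charP_two_of_algebra F
  rw [conic, Set.mem_union, Set.mem_singleton_iff, Set.mem_range, conicForm]
  constructor
  · rintro (⟨ξ, h⟩ | h)
    · rw [Projectivization.mk_eq_mk_iff'] at h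
      obtain ⟨c, hc⟩ := h
      have hc0 : c ≠ 0 := by
        rintro rfl
        rw [zero_smul] at hc
        exact one_ne_zero (congrFun hc.symm 2)
      have h0 : c * v 0 = ξ := congrFun hc 0
      have h1 : c * v 1 = ξ ^ 2 := congrFun hc 1
      have h2 : c * v 2 = 1 := congrFun hc 2
      have : c ^ 2 * (v 0 ^ 2 + v 1 * v 2) = 0 := by
        have e : c ^ 2 * (v 0 ^ 2 + v 1 * v 2) = (c * v 0) ^ 2 + (c * v 1) * (c * v 2) := by ring
        rw [e, h0, h1, h2, mul_one, CharTwo.add_self_eq_zero]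
      exact (mul_eq_zero.mp this).resolve_left (pow_ne_zero 2 hc0)
    · rw [Projectivization.mk_eq_mk_iff'] at h
      obtain ⟨c, hc⟩ := h
      have h0 : 0 = v 0 := by simpa using congrFun hc 0
      have h2 : 0 = v 2 := by simpa using congrFun hc 2
      rw [← h0, ← h2]
      ring
  · intro h
    by_cases h2 : v 2 = 0
    · right
      have h0 : v 0 = 0 := by
        rw [h2, mul_zero, add_zero] at h
        exact pow_eq_zero_iff two_ne_zero |>.mp h
      rw [Projectivization.mk_eq_mk_iff']
      refine ⟨v 1, ?_⟩
      ext i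
      fin_cases i <;> simp [h0, h2]
    · left
      refine ⟨v 0 / v 2, ?_⟩
      rw [Projectivization.mk_eq_mk_iff']
      refine ⟨(v 2)⁻¹, ?_⟩
      have h1 : v 0 ^ 2 = v 1 * v 2 := CharTwo.add_eq_zero.mp h
      ext i
      fin_cases i
      · simp [div_eq_inv_mul]
      · simp only [Pi.smul_apply, smul_eq_mul, Fin.mk_one, Matrix.cons_val_one,
          Matrix.cons_val_zero]
        rw [div_pow, h1]
        field_simp
      · simp [h2]

theorem lineOf_injective {x y z u : F} (h : lineOf x y = lineOf z u) : x = z ∧ y = u := by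
  have := charP_two_of_algebra F
  have h1 : (Projectivization.mk F ![x, 1, 0] (fun h => one_ne_zero (congrFun h 1)) :
      ProjPlane F) ∈ lineOf x y := by
    rw [mk_mem_lineOf]
    simp [CharTwo.add_self_eq_zero]
  have h2 : (Projectivization.mk F ![y, 0, 1] (fun h => one_ne_zero (congrFun h 2)) :
      ProjPlane F) ∈ lineOf x y := by
    rw [mk_mem_lineOf]
    simp [CharTwo.add_self_eq_zero]
  rw [h, mk_mem_lineOf] at h1 h2
  simp only [Matrix.cons_val_zero, Matrix.cons_val_one, Matrix.cons_val, one_mul, zero_mul,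
    add_zero] at h1 h2
  exact ⟨CharTwo.add_eq_zero.mp h1, CharTwo.add_eq_zero.mp h2⟩

variable [Finite F]

theorem quadratic_ne_zero_iff {x : F} (hx : x ≠ 0) (y : F) :
    (∀ ξ : F, x * ξ ^ 2 + ξ + y ≠ 0) ↔ Algebra.trace (ZMod 2) F (x * y) = 1 := by
  have := charP_two_of_algebra F
  constructor
  · intro h
    refine (ZMod.eq_zero_or_eq_one _).resolve_left fun h0 => ?_
    obtain ⟨s, hs⟩ := exists_sq_add_self_eq h0
    refine h (s / x) ?_
    have h2 : x * (x * (s / x) ^ 2 + s / x + y) = 0 := by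
      have e : x * (x * (s / x) ^ 2 + s / x + y) = (s ^ 2 + s) + x * y := by field_simp
      rw [e, hs, CharTwo.add_self_eq_zero]
    exact (mul_eq_zero.mp h2).resolve_left hx
  · intro h ξ h0
    have : x * y = (x * ξ) ^ 2 + x * ξ := by
      rw [← CharTwo.add_eq_zero]
      linear_combination x * h0
    rw [this, trace_sq_add_self] at h
    exact zero_ne_one h

theorem lineOf_inter_conic_eq_empty_iff (x y : F) :
    lineOf x y ∩ conic F = ∅ ↔ x ≠ 0 ∧ Algebra.trace (ZMod 2) F (x * y) = 1 := by
  rw [Set.eq_empty_iff_forall_notMem]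
  have hinf : (Projectivization.mk F ![0, 1, 0] (fun h => one_ne_zero (congrFun h 1)) :
      ProjPlane F) ∈ lineOf x y ↔ x = 0 := by
    rw [mk_mem_lineOf]
    simp
  have haff : ∀ ξ : F, (Projectivization.mk F ![ξ, ξ ^ 2, 1]
      (fun h => one_ne_zero (congrFun h 2)) : ProjPlane F) ∈ lineOf x y ↔
        x * ξ ^ 2 + ξ + y = 0 := fun ξ => by
    rw [mk_mem_lineOf]
    simp [mul_comm, add_comm]
  constructor
  · intro h
    have hx : x ≠ 0 := fun hx => h _ ⟨hinf.mpr hx, Or.inr rfl⟩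
    refine ⟨hx, (quadratic_ne_zero_iff hx y).mp fun ξ hξ => ?_⟩
    exact h _ ⟨(haff ξ).mpr hξ, Or.inl ⟨ξ, rfl⟩⟩
  · rintro ⟨hx, h⟩ p ⟨hp, ⟨ξ, rfl⟩ | rfl⟩
    · exact (quadratic_ne_zero_iff hx y).mpr h ξ ((haff ξ).mp hp)
    · exact hx (hinf.mp hp)

theorem ExteriorLine.exists_eq_lineOf (l : ExteriorLine F) : ∃ x y : F, l.1 = lineOf x y := by
  have := charP_two_of_algebra F
  obtain ⟨⟨w, hw⟩, hl⟩ := l.2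
  induction w using Projectivization.ind with | h w hw0 =>
  have hmem : ∀ (v : Fin 3 → F) (hv : v ≠ 0), Projectivization.mk F v hv ∈ l.1 ↔
      v 0 * w 0 + v 1 * w 1 + v 2 * w 2 = 0 := fun v hv => by
    rw [hw]
    change (Projectivization.mk F v hv).orthogonal (Projectivization.mk F w hw0) ↔ _
    rw [Projectivization.orthogonal_mk]
    simp [dotProduct, Fin.sum_univ_three]
  by_cases h0 : w 0 = 0
  · -- A line through the nucleus `(1, 0, 0)` of the conic is a tangent.
    exfalso
    obtain ⟨a, ha⟩ := exists_sq_eq (w 1)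
    obtain ⟨b, hb⟩ := exists_sq_eq (w 2)
    have hv : ![a * b, b ^ 2, a ^ 2] ≠ 0 := fun hv => hw0 <| by
      have h1 : b ^ 2 = 0 := congrFun hv 1
      have h2 : a ^ 2 = 0 := congrFun hv 2
      ext i
      fin_cases i
      · exact h0
      · exact ha.symm.trans h2
      · exact hb.symm.trans h1
    have : Projectivization.mk F _ hv ∈ l.1 ∩ conic F := by
      refine ⟨(hmem _ hv).mpr ?_, (mk_mem_conic hv).mpr ?_⟩
      · simp [h0, ← ha, ← hb, mul_comm, CharTwo.add_self_eq_zero]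
      · simp only [conicForm, Matrix.cons_val_zero, Matrix.cons_val_one, Matrix.cons_val]
        rw [mul_pow, mul_comm, CharTwo.add_self_eq_zero]
    rw [hl] at this
    exact this
  · refine ⟨w 1 / w 0, w 2 / w 0, ?_⟩
    ext p
    induction p using Projectivization.ind with | h v hv =>
    rw [hmem, mk_mem_lineOf]
    have : v 0 * w 0 + v 1 * w 1 + v 2 * w 2 =
        w 0 * (v 0 + v 1 * (w 1 / w 0) + v 2 * (w 2 / w 0)) := by field_simp
    rw [this, mul_eq_zero, or_iff_right h0]

/-- The exterior lines are the lines `(1,x,y)^⊥` with `x ≠ 0` and `Tr(xy) = 1`. -/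
noncomputable def exteriorLineEquiv :
    {p : F × F // p.1 ≠ 0 ∧ Algebra.trace (ZMod 2) F (p.1 * p.2) = 1} ≃ ExteriorLine F :=
  Equiv.ofBijective
    (fun p => ⟨lineOf p.1.1 p.1.2, ⟨_, rfl⟩, (lineOf_inter_conic_eq_empty_iff _ _).mpr p.2⟩)
    ⟨fun p r h => by
      obtain ⟨h1, h2⟩ := lineOf_injective (congrArg Subtype.val h)
      exact Subtype.ext (Prod.ext h1 h2), fun l => by
      obtain ⟨x, y, h⟩ := l.exists_eq_lineOf
      exact ⟨⟨(x, y), (lineOf_inter_conic_eq_empty_iff x y).mp (h ▸ l.2.2)⟩,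
        Subtype.ext h.symm⟩⟩

namespace ExteriorLine

/-- The coordinate `x` of the exterior line `(1,x,y)^⊥`. -/
noncomputable def fst (l : ExteriorLine F) : F := (exteriorLineEquiv.symm l).1.1

/-- The coordinate `y` of the exterior line `(1,x,y)^⊥`. -/
noncomputable def snd (l : ExteriorLine F) : F := (exteriorLineEquiv.symm l).1.2

theorem eq_lineOf (l : ExteriorLine F) : l.1 = lineOf l.fst l.snd :=
  congrArg Subtype.val (exteriorLineEquiv.apply_symm_apply l).symm

theorem fst_ne_zero (l : ExteriorLine F) : l.fst ≠ 0 := (exteriorLineEquiv.symm l).2.1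

theorem trace_mul (l : ExteriorLine F) : Algebra.trace (ZMod 2) F (l.fst * l.snd) = 1 :=
  (exteriorLineEquiv.symm l).2.2

theorem ext_coords {l k : ExteriorLine F} (h1 : l.fst = k.fst) (h2 : l.snd = k.snd) : l = k :=
  Subtype.ext (by rw [l.eq_lineOf, k.eq_lineOf, h1, h2])

theorem eq_coords {l : ExteriorLine F} {x y : F} (h : l.1 = lineOf x y) :
    l.fst = x ∧ l.snd = y := lineOf_injective (l.eq_lineOf.symm.trans h)

theorem exists_coords {x y : F} (hx : x ≠ 0) (h : Algebra.trace (ZMod 2) F (x * y) = 1) :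
    ∃ l : ExteriorLine F, l.fst = x ∧ l.snd = y :=
  ⟨exteriorLineEquiv ⟨(x, y), hx, h⟩, by simp [fst], by simp [snd]⟩

/-- The function `ρ̂` on pairs of exterior lines. -/
noncomputable def rho (l k : ExteriorLine F) : F := rhoHat l.fst l.snd k.fst k.snd

theorem mem_ellipticRel {a : F} {p : ExteriorLine F × ExteriorLine F} :
    p ∈ ellipticRel a ↔ rho p.1 p.2 = a := by
  constructor
  · rintro ⟨x, y, z, u, h1, h2, h⟩
    obtain ⟨rfl, rfl⟩ := eq_coords h1
    obtain ⟨rfl, rfl⟩ := eq_coords h2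
    exact h
  · intro h
    exact ⟨_, _, _, _, p.1.eq_lineOf, p.2.eq_lineOf, h⟩

theorem rho_comm (l k : ExteriorLine F) : rho l k = rho k l := by
  simp only [rho, rhoHat]
  ring

theorem trace_rho (l k : ExteriorLine F) : Algebra.trace (ZMod 2) F (rho l k) = 0 := by
  have := charP_two_of_algebra F
  have e : rho l k = (l.fst * k.snd + l.snd * k.fst) ^ 2 + (l.fst * k.snd + l.snd * k.fst) +
      (l.fst * l.snd + k.fst * k.snd) := by
    simp only [rho, rhoHat]
    linear_combination (-(l.fst * k.snd * l.snd * k.fst)) * CharTwo.two_eq_zero (R := F)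
  rw [e, map_add, trace_sq_add_self, map_add, trace_mul, trace_mul, zero_add,
    CharTwo.add_self_eq_zero]

theorem rho_eq_zero_iff (l k : ExteriorLine F) : rho l k = 0 ↔ l = k := by
  have := charP_two_of_algebra F
  have h2 := CharTwo.two_eq_zero (R := F)
  constructor
  · intro h
    simp only [rho, rhoHat] at h
    have hx := l.fst_ne_zero
    have htr := l.trace_mul
    set x := l.fst
    set y := l.snd
    by_cases hd : x + k.fst = 0
    · have hz : x = k.fst := CharTwo.add_eq_zero.mp hd
      refine ext_coords hz ?_
      rw [← hz] at h
      have : (x * (y + k.snd)) ^ 2 = 0 := by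
        linear_combination h - (x * (y + k.snd) - x ^ 2 * y * k.snd) * h2
      have := (mul_eq_zero.mp (pow_eq_zero_iff two_ne_zero |>.mp this)).resolve_left hx
      exact CharTwo.add_eq_zero.mp this
    · -- a square root of `(y + u) / (x + z)` is a zero of `x ξ² + ξ + y`
      exfalso
      obtain ⟨ξ, hξ⟩ := exists_sq_eq ((y + k.snd) / (x + k.fst))
      refine (quadratic_ne_zero_iff hx y).mpr htr ξ (pow_eq_zero_iff two_ne_zero |>.mp ?_)
      have he : ξ ^ 2 * (x + k.fst) = y + k.snd := by rw [hξ, div_mul_cancel₀ _ hd]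
      have hk : k.snd = y + ξ ^ 2 * (x + k.fst) := by linear_combination -he - (y) * h2
      rw [hk] at h
      have hmul : (x + k.fst) ^ 2 * (x * ξ ^ 2 + ξ + y) ^ 2 = 0 := by
        linear_combination h + (x * k.fst * y ^ 2 + (x + k.fst) ^ 2 *
          (x * ξ ^ 3 + x * y * ξ ^ 2 + ξ * y) - x ^ 2 * y * ξ ^ 2 * (x + k.fst) -
          (x + k.fst) * y) * h2
      exact (mul_eq_zero.mp hmul).resolve_left (pow_ne_zero 2 hd)
  · rintro rfl
    simp only [rho, rhoHat]
    linear_combination (l.fst ^ 2 * l.snd ^ 2 + 2 * l.fst * l.snd) * h2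

end ExteriorLine

end Coordinates

/-! ### The stabilizer of the conic -/

section Stabilizer

variable {F : Type*} [Field F]

theorem exists_perm_of_semilinear (σ : F ≃+* F) (f : (Fin 3 → F) ≃+ (Fin 3 → F))
    (hf : ∀ (c : F) (v : Fin 3 → F), f (c • v) = σ c • f v) :
    ∃ π : Equiv.Perm (ProjPlane F), ∀ (v : Fin 3 → F) (hv : v ≠ 0),
      π (Projectivization.mk F v hv) =
        Projectivization.mk F (f v) ((map_ne_zero_iff f f.injective).mpr hv) := by
  let g : (Fin 3 → F) →ₛₗ[(σ : F →+* F)] (Fin 3 → F) :=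
    { toFun := f, map_add' := f.map_add, map_smul' := hf }
  have hg : Function.Injective g := f.injective
  let σ' : F →+* F := (σ.symm : F →+* F)
  have : RingHomInvPair (σ : F →+* F) σ' :=
    ⟨RingHom.ext σ.symm_apply_apply, RingHom.ext σ.apply_symm_apply⟩
  refine ⟨Equiv.ofBijective (Projectivization.map g hg)
    ⟨Projectivization.map_injective (τ := σ') g hg, fun p => ?_⟩, fun v hv => rfl⟩
  induction p using Projectivization.ind with | h w hw =>
  have hv : f.symm w ≠ 0 := (map_ne_zero_iff f.symm f.symm.injective).mpr hw
  refine ⟨Projectivization.mk F (f.symm w) hv, ?_⟩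
  rw [Projectivization.map_mk]
  congr 1
  exact f.apply_symm_apply w

theorem smul_lineOf {π : Equiv.Perm (ProjPlane F)} {σ : F ≃+* F} {f : (Fin 3 → F) → (Fin 3 → F)}
    (hf0 : ∀ v, v ≠ 0 → f v ≠ 0)
    (hπ : ∀ (v : Fin 3 → F) (hv : v ≠ 0),
      π (Projectivization.mk F v hv) = Projectivization.mk F (f v) (hf0 v hv))
    {x y x' y' c : F} (hc : c ≠ 0)
    (h : ∀ v, f v 0 + f v 1 * x' + f v 2 * y' = c * σ (v 0 + v 1 * x + v 2 * y)) :
    π • lineOf x y = lineOf x' y' := by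
  ext p
  rw [Set.mem_smul_set_iff_inv_smul_mem]
  obtain ⟨p, rfl⟩ := π.surjective p
  induction p using Projectivization.ind with | h v hv =>
  change π⁻¹ • π • Projectivization.mk F v hv ∈ _ ↔ π • Projectivization.mk F v hv ∈ _
  rw [inv_smul_smul, Equiv.Perm.smul_def, hπ, mk_mem_lineOf, mk_mem_lineOf, h, mul_eq_zero,
    or_iff_right hc, map_eq_zero_iff σ σ.injective]

/-- Applied to the values of a quadratic form at the points `(ξ, ξ², 1)`, this determines the forms
vanishing on the conic up to a scalar. -/
theorem quartic_coeffs_eq_zero [Fintype F] (hF : 4 < Fintype.card F) {a b c d e : F}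
    (h : ∀ η : F, a * η ^ 4 + b * η ^ 3 + c * η ^ 2 + d * η + e = 0) :
    b = 0 ∧ c = 0 ∧ d = 0 ∧ e = 0 := by
  open Polynomial in
  have hp : (C a * X ^ 4 + C b * X ^ 3 + C c * X ^ 2 + C d * X + C e : F[X]) = 0 := by
    refine Polynomial.eq_zero_of_natDegree_lt_card_of_eval_eq_zero' _ Finset.univ
      (fun η _ => ?_) ?_
    · simpa using h η
    · rw [Finset.card_univ]
      refine lt_of_le_of_lt ?_ hF
      compute_degree
  refine ⟨?_, ?_, ?_, ?_⟩
  · simpa [Polynomial.coeff_X, Polynomial.coeff_C, Polynomial.coeff_X_pow] using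
      congrArg (fun p => p.coeff 3) hp
  · simpa [Polynomial.coeff_X, Polynomial.coeff_C, Polynomial.coeff_X_pow] using
      congrArg (fun p => p.coeff 2) hp
  · simpa [Polynomial.coeff_X, Polynomial.coeff_C, Polynomial.coeff_X_pow] using
      congrArg (fun p => p.coeff 1) hp
  · simpa [Polynomial.coeff_X, Polynomial.coeff_C, Polynomial.coeff_X_pow] using
      congrArg (fun p => p.coeff 0) hp

theorem conicStabilizer_mono {S S' : Subgroup (F ≃+* F)} (h : S ≤ S') :
    conicStabilizer S ≤ conicStabilizer S' := fun _ hπ =>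
  ⟨let ⟨σ, hσ, hi⟩ := hπ.1; ⟨σ, h hσ, hi⟩, hπ.2⟩

variable [Algebra (ZMod 2) F]

theorem mem_conicStabilizer_of_conicForm {S : Subgroup (F ≃+* F)} {σ : F ≃+* F} (hσ : σ ∈ S)
    (f : (Fin 3 → F) ≃+ (Fin 3 → F)) (hf : ∀ (c : F) (v : Fin 3 → F), f (c • v) = σ c • f v)
    (hQ : ∀ v, conicForm (f v) = σ (conicForm v)) {π : Equiv.Perm (ProjPlane F)}
    (hπ : ∀ (v : Fin 3 → F) (hv : v ≠ 0), π (Projectivization.mk F v hv) =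
      Projectivization.mk F (f v) ((map_ne_zero_iff f f.injective).mpr hv)) :
    π ∈ conicStabilizer S := by
  refine ⟨⟨σ, hσ, f, hf, hπ⟩, ?_⟩
  change π • conic F = conic F
  ext p
  rw [Set.mem_smul_set_iff_inv_smul_mem]
  obtain ⟨p, rfl⟩ := π.surjective p
  induction p using Projectivization.ind with | h v hv =>
  change π⁻¹ • π • Projectivization.mk F v hv ∈ _ ↔ π • Projectivization.mk F v hv ∈ _
  rw [inv_smul_smul, Equiv.Perm.smul_def, hπ, mk_mem_conic, mk_mem_conic, hQ,
    map_eq_zero_iff σ σ.injective]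

/-- The action on lines of a semilinear map preserving the conic, with companion automorphism `σ`
and matrix columns `(t,0,0)`, `(p,α,γ)`, `(r,β,δ)`. -/
theorem exists_smul_lineOf_eq [Fintype F] (hF : 4 < Fintype.card F) {σ : F ≃+* F}
    {π : Equiv.Perm (ProjPlane F)} (hσ : IsInducedBySemilinear σ π) (hπ : π • conic F = conic F) :
    ∃ t p r α β γ δ : F, t ≠ 0 ∧ α * δ + β * γ = t ^ 2 ∧ p ^ 2 = α * γ ∧ r ^ 2 = β * δ ∧
      ∀ x y : F, π • lineOf x y =
        lineOf ((δ * (t * σ x + p) + γ * (t * σ y + r)) / t ^ 2)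
          ((β * (t * σ x + p) + α * (t * σ y + r)) / t ^ 2) := by
  have := charP_two_of_algebra F
  have h2 := CharTwo.two_eq_zero (R := F)
  obtain ⟨f, hf, hf'⟩ := hσ
  set c₀ := f ![1, 0, 0] with hc₀
  set c₁ := f ![0, 1, 0] with hc₁
  set c₂ := f ![0, 0, 1] with hc₂
  have hfv : ∀ v i, f v i = σ (v 0) * c₀ i + σ (v 1) * c₁ i + σ (v 2) * c₂ i := fun v i => by
    have hv : v = v 0 • ![1, 0, 0] + v 1 • ![0, 1, 0] + v 2 • ![0, 0, 1] := by
      ext j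
      fin_cases j <;> simp
    conv_lhs => rw [hv]
    rw [map_add, map_add, hf, hf, hf]
    rfl
  have hQ : ∀ v, conicForm v = 0 → conicForm (f v) = 0 := fun v hv => by
    by_cases hv0 : v = 0
    · rw [hv0, map_zero]
      simp [conicForm]
    · rw [← mk_mem_conic ((map_ne_zero_iff f f.injective).mpr hv0), ← hf' v hv0, ← hπ]
      exact Set.smul_mem_smul_set ((mk_mem_conic hv0).mpr hv)
  have hQ1 : conicForm c₁ = 0 := hQ _ (by simp [conicForm])
  have hpoly : ∀ η : F, conicForm c₁ * η ^ 4 + (c₀ 1 * c₁ 2 + c₀ 2 * c₁ 1) * η ^ 3 +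
      (conicForm c₀ + (c₁ 1 * c₂ 2 + c₁ 2 * c₂ 1)) * η ^ 2 +
      (c₀ 1 * c₂ 2 + c₀ 2 * c₂ 1) * η + conicForm c₂ = 0 := fun η => by
    have h1 := hQ ![σ.symm η, (σ.symm η) ^ 2, 1] (by
      simp [conicForm, CharTwo.add_self_eq_zero])
    simp only [conicForm, hfv, Matrix.cons_val_zero, Matrix.cons_val_one, Matrix.cons_val, map_pow,
      map_one, RingEquiv.apply_symm_apply] at h1
    simp only [conicForm]
    linear_combination h1 - (η ^ 3 * c₀ 0 * c₁ 0 + η ^ 2 * c₁ 0 * c₂ 0 + η * c₀ 0 * c₂ 0) * h2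
  obtain ⟨h01, h012, h02, hQ2⟩ := quartic_coeffs_eq_zero hF hpoly
  -- `c₀` is orthogonal to all vectors for the polar form of the conic
  have hrad : ∀ w : Fin 3 → F, c₀ 1 * w 2 + c₀ 2 * w 1 = 0 := fun w => by
    obtain ⟨v, rfl⟩ := f.surjective w
    rw [hfv, hfv]
    linear_combination σ (v 1) * h01 + σ (v 2) * h02 + σ (v 0) * c₀ 1 * c₀ 2 * h2
  have hc01 : c₀ 1 = 0 := by simpa using hrad ![0, 0, 1]
  have hc02 : c₀ 2 = 0 := by simpa using hrad ![0, 1, 0]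
  have ht : c₀ 0 ≠ 0 := fun h0 => by
    have hz : c₀ = 0 := by
      ext i
      fin_cases i
      exacts [h0, hc01, hc02]
    rw [hc₀, map_eq_zero_iff f f.injective] at hz
    exact one_ne_zero (congrFun hz 0)
  have hdet : c₁ 1 * c₂ 2 + c₂ 1 * c₁ 2 = c₀ 0 ^ 2 := by
    rw [← CharTwo.add_eq_zero]
    simp only [conicForm, hc01, hc02] at h012
    linear_combination h012
  refine ⟨c₀ 0, c₁ 0, c₂ 0, c₁ 1, c₂ 1, c₁ 2, c₂ 2, ht, hdet,
    CharTwo.add_eq_zero.mp hQ1, CharTwo.add_eq_zero.mp hQ2, fun x y => ?_⟩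
  refine smul_lineOf (σ := σ) (f := f) (fun v hv => (map_ne_zero_iff f f.injective).mpr hv) hf' ht
    fun v => ?_
  rw [hfv, hfv, hfv, hc01, hc02]
  simp only [map_add, map_mul]
  field_simp
  linear_combination (σ (v 1) * (c₀ 0 * σ x + c₁ 0) + σ (v 2) * (c₀ 0 * σ y + c₂ 0)) * hdet +
    (σ (v 1) * (c₁ 1 * c₁ 2 * (c₀ 0 * σ y + c₂ 0)) + σ (v 2) * (c₂ 1 * c₂ 2 *
      (c₀ 0 * σ x + c₁ 0)) + σ (v 1) * c₀ 0 ^ 2 * c₁ 0 + σ (v 2) * c₀ 0 ^ 2 * c₂ 0) * h2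

/-- `ρ̂` is unchanged by the action of a matrix preserving the conic on the coordinates. -/
theorem rhoHat_transform {t p r α β γ δ : F} (ht : t ≠ 0) (hdet : α * δ + β * γ = t ^ 2)
    (hp : p ^ 2 = α * γ) (hr : r ^ 2 = β * δ) (x y z u : F) :
    rhoHat ((δ * (t * x + p) + γ * (t * y + r)) / t ^ 2)
      ((β * (t * x + p) + α * (t * y + r)) / t ^ 2)
      ((δ * (t * z + p) + γ * (t * u + r)) / t ^ 2)
      ((β * (t * z + p) + α * (t * u + r)) / t ^ 2) = rhoHat x y z u := by
  have := charP_two_of_algebra F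
  have h2 := CharTwo.two_eq_zero (R := F)
  have hsq : ∀ a b : F, (a + b) ^ 2 = a ^ 2 + b ^ 2 := CharTwo.add_sq
  have hpoly : ∀ x y z u : F, rhoHat x y z u = (x * u + y * z) ^ 2 + (x + z) * (y + u) :=
    fun x y z u => by rw [rhoHat, hsq, mul_pow, mul_pow]
  set A := δ * (t * x + p) + γ * (t * y + r) with hA
  set B := β * (t * x + p) + α * (t * y + r) with hB
  set C := δ * (t * z + p) + γ * (t * u + r) with hC
  set D := β * (t * z + p) + α * (t * u + r) with hD
  have h1 : A * D + B * C = t ^ 3 * (t * (x * u + y * z) + r * (x + z) + p * (y + u)) := by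
    rw [hA, hB, hC, hD]
    linear_combination ((t * x + p) * (t * u + r) + (t * y + r) * (t * z + p)) * hdet +
      (β * δ * (t * x + p) * (t * z + p) + α * γ * (t * y + r) * (t * u + r) + t ^ 2 * p * r) * h2
  have h3 : A + C = t * (δ * (x + z) + γ * (y + u)) := by
    linear_combination (δ * p + γ * r) * h2
  have h4 : B + D = t * (β * (x + z) + α * (y + u)) := by
    linear_combination (β * p + α * r) * h2
  rw [hpoly, hpoly]
  have h5 : (A / t ^ 2 * (D / t ^ 2) + B / t ^ 2 * (C / t ^ 2)) ^ 2 +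
      (A / t ^ 2 + C / t ^ 2) * (B / t ^ 2 + D / t ^ 2) =
      ((A * D + B * C) ^ 2 + t ^ 4 * ((A + C) * (B + D))) / t ^ 8 := by
    field_simp
  rw [h5, h1, h3, h4, div_eq_iff (pow_ne_zero 8 ht), mul_pow, hsq, hsq]
  linear_combination t ^ 6 * (x + z) ^ 2 * hr + t ^ 6 * (y + u) ^ 2 * hp +
    t ^ 6 * (x + z) * (y + u) * hdet +
    t ^ 6 * (β * δ * (x + z) ^ 2 + α * γ * (y + u) ^ 2) * h2

end Stabilizer

/-! ### Invariance of `ρ̂` and transitivity -/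

section Transitivity

variable {F : Type*} [Field F] [Algebra (ZMod 2) F]

open ExteriorLine

theorem rho_smul_smul [Fintype F] (hF : 4 < Fintype.card F) {S : Subgroup (F ≃+* F)}
    (g : conicStabilizer S) :
    ∃ σ ∈ S, ∀ l k : ExteriorLine F, rho (g • l) (g • k) = σ (rho l k) := by
  obtain ⟨⟨σ, hσ, hi⟩, hg⟩ := g.2
  obtain ⟨t, p, r, α, β, γ, δ, ht, hdet, hp, hr, h⟩ := exists_smul_lineOf_eq hF hi hg
  refine ⟨σ, hσ, fun l k => ?_⟩
  have hact : ∀ l : ExteriorLine F, (g • l).1 =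
      lineOf ((δ * (t * σ l.fst + p) + γ * (t * σ l.snd + r)) / t ^ 2)
        ((β * (t * σ l.fst + p) + α * (t * σ l.snd + r)) / t ^ 2) := fun l => by
    rw [← h, ← l.eq_lineOf]
    rfl
  rw [rho, (eq_coords (hact l)).1, (eq_coords (hact l)).2, (eq_coords (hact k)).1,
    (eq_coords (hact k)).2, rhoHat_transform ht hdet hp hr]
  simp [rho, rhoHat]

/-- The matrices with columns `(1,0,0)`, `(p,α,γ)`, `(r,β,δ)` preserving the conic form, acting on
the coordinates of lines. -/
theorem exists_conicStabilizer_smul_eq [Finite F] (S : Subgroup (F ≃+* F)) {p r α β γ δ : F}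
    (hdet : α * δ + β * γ = 1) (hp : p ^ 2 = α * γ) (hr : r ^ 2 = β * δ) :
    ∃ g : conicStabilizer S, ∀ l : ExteriorLine F,
      (g • l).fst = δ * (l.fst + p) + γ * (l.snd + r) ∧
      (g • l).snd = β * (l.fst + p) + α * (l.snd + r) := by
  have := charP_two_of_algebra F
  have h2 := CharTwo.two_eq_zero (R := F)
  let f : (Fin 3 → F) ≃+ (Fin 3 → F) :=
    { toFun := fun v => ![v 0 + p * v 1 + r * v 2, α * v 1 + β * v 2, γ * v 1 + δ * v 2]
      invFun := fun b => ![b 0 + p * (δ * b 1 + β * b 2) + r * (γ * b 1 + α * b 2),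
        δ * b 1 + β * b 2, γ * b 1 + α * b 2]
      left_inv := fun v => by
        have e1 : δ * (α * v 1 + β * v 2) + β * (γ * v 1 + δ * v 2) = v 1 := by
          linear_combination v 1 * hdet + β * δ * v 2 * h2
        have e2 : γ * (α * v 1 + β * v 2) + α * (γ * v 1 + δ * v 2) = v 2 := by
          linear_combination v 2 * hdet + α * γ * v 1 * h2
        ext i
        fin_cases i
        · simp only [Matrix.cons_val_zero, Matrix.cons_val_one, Matrix.cons_val, Fin.zero_eta]
          rw [e1, e2]
          linear_combination (p * v 1 + r * v 2) * h2
        · exact e1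
        · exact e2
      right_inv := fun b => by
        ext i
        fin_cases i
        · simp only [Matrix.cons_val_zero, Matrix.cons_val_one, Matrix.cons_val, Fin.zero_eta]
          linear_combination (p * (δ * b 1 + β * b 2) + r * (γ * b 1 + α * b 2)) * h2
        · simp only [Matrix.cons_val_zero, Matrix.cons_val_one, Matrix.cons_val, Fin.mk_one]
          linear_combination b 1 * hdet + α * β * b 2 * h2
        · simp only [Matrix.cons_val_zero, Matrix.cons_val_one, Matrix.cons_val, Fin.reduceFinMk]
          linear_combination b 2 * hdet + γ * δ * b 1 * h2
      map_add' := fun v w => by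
        ext i
        fin_cases i
        · simp only [Matrix.cons_val_zero, Pi.add_apply, Fin.zero_eta]
          ring
        · simp only [Matrix.cons_val_one, Matrix.cons_val_zero, Pi.add_apply, Fin.mk_one]
          ring
        · simp only [Matrix.cons_val, Pi.add_apply, Fin.reduceFinMk]
          ring }
  have hfv : ∀ v, f v = ![v 0 + p * v 1 + r * v 2, α * v 1 + β * v 2, γ * v 1 + δ * v 2] :=
    fun v => rfl
  have hf : ∀ (c : F) (v : Fin 3 → F), f (c • v) = (1 : F ≃+* F) c • f v := fun c v => by
    rw [hfv, hfv]
    ext i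
    fin_cases i
    · simp only [Matrix.cons_val_zero, Pi.smul_apply, smul_eq_mul, Fin.zero_eta, RingAut.one_apply]
      ring
    · simp only [Matrix.cons_val_one, Matrix.cons_val_zero, Pi.smul_apply, smul_eq_mul, Fin.mk_one,
        RingAut.one_apply]
      ring
    · simp only [Matrix.cons_val, Pi.smul_apply, smul_eq_mul, Fin.reduceFinMk, RingAut.one_apply]
      ring
  obtain ⟨π, hπ⟩ := exists_perm_of_semilinear 1 f hf
  have hmem : π ∈ conicStabilizer S := by
    refine mem_conicStabilizer_of_conicForm S.one_mem f hf (fun v => ?_) hπ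
    rw [hfv]
    simp only [conicForm, Matrix.cons_val_zero, Matrix.cons_val_one, Matrix.cons_val,
      RingAut.one_apply]
    linear_combination v 1 * v 2 * hdet + v 1 ^ 2 * hp + v 2 ^ 2 * hr +
      (v 1 ^ 2 * α * γ + v 2 ^ 2 * β * δ + v 0 * (p * v 1 + r * v 2) + p * v 1 * r * v 2) * h2
  refine ⟨⟨π, hmem⟩, fun l => eq_coords ?_⟩
  change π • l.1 = _
  rw [l.eq_lineOf]
  refine smul_lineOf (σ := 1) (f := f) (c := 1)
    (fun v hv => (map_ne_zero_iff f f.injective).mpr hv) hπ one_ne_zero fun v => ?_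
  rw [hfv]
  simp only [Matrix.cons_val_zero, Matrix.cons_val_one, Matrix.cons_val, RingAut.one_apply]
  linear_combination (v 1 * (l.fst + p) + v 2 * (l.snd + r)) * hdet +
    (v 1 * (p + α * γ * (l.snd + r)) + v 2 * (r + β * δ * (l.fst + p))) * h2

/-- Field automorphisms, applied to the coordinates of the plane, fix the conic. -/
theorem exists_conicStabilizer_smul_eq_map [Finite F] {S : Subgroup (F ≃+* F)} {σ : F ≃+* F}
    (hσ : σ ∈ S) :
    ∃ g : conicStabilizer S, ∀ l : ExteriorLine F,
      (g • l).fst = σ l.fst ∧ (g • l).snd = σ l.snd := by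
  let f : (Fin 3 → F) ≃+ (Fin 3 → F) := AddEquiv.piCongrRight fun _ => σ.toAddEquiv
  have hfv : ∀ v i, f v i = σ (v i) := fun v i => rfl
  have hf : ∀ (c : F) (v : Fin 3 → F), f (c • v) = σ c • f v := fun c v => by
    ext i
    simp [hfv]
  obtain ⟨π, hπ⟩ := exists_perm_of_semilinear σ f hf
  have hmem : π ∈ conicStabilizer S := by
    refine mem_conicStabilizer_of_conicForm hσ f hf (fun v => ?_) hπ
    simp [conicForm, hfv]
  refine ⟨⟨π, hmem⟩, fun l => eq_coords ?_⟩
  change π • l.1 = _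
  rw [l.eq_lineOf]
  refine smul_lineOf (σ := σ) (f := f) (c := 1)
    (fun v hv => (map_ne_zero_iff f f.injective).mpr hv) hπ one_ne_zero fun v => ?_
  simp [hfv]

variable [Finite F]

/-- Lines with the same first coordinate can be shifted into each other. -/
theorem exists_smul_snd_eq_add (S : Subgroup (F ≃+* F)) {x d : F} (hx : x ≠ 0)
    (h : Algebra.trace (ZMod 2) F (x * d) = 0) :
    ∃ g : conicStabilizer S, ∀ l : ExteriorLine F, l.fst = x →
      (g • l).fst = x ∧ (g • l).snd = l.snd + d := by
  obtain ⟨b, hb⟩ := exists_sq_add_self_eq h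
  obtain ⟨g, hg⟩ := exists_conicStabilizer_smul_eq S (p := 0) (r := b / x) (α := 1)
    (β := (b / x) ^ 2) (γ := 0) (δ := 1) (by ring) (by ring) (by ring)
  refine ⟨g, fun l hl => ⟨by rw [(hg l).1, hl]; ring, ?_⟩⟩
  rw [(hg l).2, hl]
  field_simp
  linear_combination x * hb

theorem exists_smul_eq (S : Subgroup (F ≃+* F)) (l l' : ExteriorLine F) :
    ∃ g : conicStabilizer S, g • l = l' := by
  have := charP_two_of_algebra F
  have hnorm : ∀ l : ExteriorLine F, ∃ g : conicStabilizer S, (g • l).fst = 1 := fun l => by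
    have hl := l.fst_ne_zero
    obtain ⟨g, hg⟩ := exists_conicStabilizer_smul_eq S (p := 0) (r := 0) (α := l.fst)
      (β := 0) (γ := 0) (δ := l.fst⁻¹) (by field_simp; ring) (by ring) (by ring)
    refine ⟨g, ?_⟩
    rw [(hg l).1]
    field_simp
    ring
  obtain ⟨g, hg⟩ := hnorm l
  obtain ⟨g', hg'⟩ := hnorm l'
  have h1 := (g • l).trace_mul
  have h2 := (g' • l').trace_mul
  rw [hg, one_mul] at h1
  rw [hg', one_mul] at h2
  obtain ⟨s, hs⟩ := exists_smul_snd_eq_add S one_ne_zero (d := (g • l).snd + (g' • l').snd) (by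
    rw [one_mul, map_add, h1, h2]
    rfl)
  refine ⟨g'⁻¹ * s * g, ?_⟩
  rw [mul_smul, mul_smul, inv_smul_eq_iff]
  refine ext_coords ((hs _ hg).1.trans hg'.symm) ?_
  rw [(hs _ hg).2, ← add_assoc, CharTwo.add_self_eq_zero, zero_add]

/-- Any two distinct exterior lines can be moved to lines `(1,c,y)^⊥` and `(1,c,y+1)^⊥`. -/
theorem exists_smul_normal_form (S : Subgroup (F ≃+* F)) {l k : ExteriorLine F} (h : l ≠ k) :
    ∃ g : conicStabilizer S, (g • l).fst = (g • k).fst ∧ (g • k).snd = (g • l).snd + 1 := by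
  have := charP_two_of_algebra F
  have h2 := CharTwo.two_eq_zero (R := F)
  have hαβ : ∃ α β : F, α * (l.snd + k.snd) + β * (l.fst + k.fst) = 1 := by
    by_cases h1 : l.fst + k.fst = 0
    · have h3 : l.snd + k.snd ≠ 0 := fun h3 =>
        h (ext_coords (CharTwo.add_eq_zero.mp h1) (CharTwo.add_eq_zero.mp h3))
      exact ⟨(l.snd + k.snd)⁻¹, 0, by rw [inv_mul_cancel₀ h3, zero_mul, add_zero]⟩
    · exact ⟨0, (l.fst + k.fst)⁻¹, by rw [inv_mul_cancel₀ h1, zero_mul, zero_add]⟩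
  obtain ⟨α, β, hdet⟩ := hαβ
  obtain ⟨p, hp⟩ := exists_sq_eq (α * (l.fst + k.fst))
  obtain ⟨r, hr⟩ := exists_sq_eq (β * (l.snd + k.snd))
  obtain ⟨g, hg⟩ := exists_conicStabilizer_smul_eq S hdet hp hr
  refine ⟨g, ?_, ?_⟩
  · rw [(hg l).1, (hg k).1, ← CharTwo.add_eq_zero]
    linear_combination ((l.snd + k.snd) * (l.fst + k.fst + p) +
      (l.fst + k.fst) * r) * h2
  · rw [(hg l).2, (hg k).2]
    linear_combination hdet - (β * l.fst + α * l.snd) * h2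

theorem exists_smul_eq_smul_eq_bot [Fintype F] (hF : 4 < Fintype.card F)
    {l k l' k' : ExteriorLine F} (h : rho l k = rho l' k') :
    ∃ g : PGLTwo F, g • l = l' ∧ g • k = k' := by
  have := charP_two_of_algebra F
  have h2 := CharTwo.two_eq_zero (R := F)
  by_cases hlk : l = k
  · have hlk' : l' = k' := by rw [← rho_eq_zero_iff, ← h, rho_eq_zero_iff, hlk]
    obtain ⟨g, hg⟩ := exists_smul_eq ⊥ l l'
    exact ⟨g, hg, by rw [← hlk, hg, hlk']⟩
  have hlk' : l' ≠ k' := fun h0 => hlk (by rw [← rho_eq_zero_iff, h, rho_eq_zero_iff, h0])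
  obtain ⟨g, hg1, hg2⟩ := exists_smul_normal_form ⊥ hlk
  obtain ⟨g', hg1', hg2'⟩ := exists_smul_normal_form ⊥ hlk'
  have hinv : ∀ (g : PGLTwo F) (l k : ExteriorLine F), rho (g • l) (g • k) = rho l k :=
    fun g l k => by
      obtain ⟨σ, hσ, hρ⟩ := rho_smul_smul hF g
      rw [hρ, Subgroup.mem_bot.mp hσ, RingAut.one_apply]
  have hsq : ∀ l k : ExteriorLine F, l.fst = k.fst → k.snd = l.snd + 1 → rho l k = l.fst ^ 2 :=
    fun l k h1 h3 => by
      rw [rho, rhoHat, ← h1, h3]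
      linear_combination
        (l.fst ^ 2 * l.snd ^ 2 + l.fst ^ 2 * l.snd + 2 * l.fst * l.snd + l.fst) * h2
  have hfst : (g • l).fst = (g' • l').fst := by
    apply CharTwo.sq_injective
    change (g • l).fst ^ 2 = (g' • l').fst ^ 2
    rw [← hsq _ _ hg1 hg2, ← hsq _ _ hg1' hg2', hinv, hinv, h]
  obtain ⟨s, hs⟩ := exists_smul_snd_eq_add ⊥ (g • l).fst_ne_zero
    (d := (g • l).snd + (g' • l').snd) (by
    rw [mul_add, map_add, trace_mul, hfst, trace_mul]
    rfl)
  have e1 : s • g • l = g' • l' := by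
    refine ext_coords ((hs _ rfl).1.trans hfst) ?_
    rw [(hs _ rfl).2, ← add_assoc, CharTwo.add_self_eq_zero, zero_add]
  have e2 : s • g • k = g' • k' := by
    refine ext_coords (((hs _ hg1.symm).1.trans hfst).trans hg1') ?_
    rw [(hs _ hg1.symm).2, hg2, hg2']
    linear_combination (g • l).snd * h2
  refine ⟨g'⁻¹ * s * g, ?_, ?_⟩
  · rw [mul_smul, mul_smul, inv_smul_eq_iff, e1]
  · rw [mul_smul, mul_smul, inv_smul_eq_iff, e2]

/-- Pairs of exterior lines with the same value of `ρ̂` are conjugate. -/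
theorem exists_smul_eq_smul_eq [Fintype F] (hF : 4 < Fintype.card F) (S : Subgroup (F ≃+* F))
    {l k l' k' : ExteriorLine F} (h : rho l k = rho l' k') :
    ∃ g : conicStabilizer S, g • l = l' ∧ g • k = k' := by
  obtain ⟨g, h1, h2⟩ := exists_smul_eq_smul_eq_bot hF h
  exact ⟨⟨g.1, conicStabilizer_mono bot_le g.2⟩, h1, h2⟩

theorem exists_rho_eq {a : F} (ha : a ∈ traceZeroStar F) : ∃ l k : ExteriorLine F, rho l k = a := by
  have := charP_two_of_algebra F
  obtain ⟨c, rfl⟩ := exists_sq_eq a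
  have hc : c ≠ 0 := fun h0 => ha.2 (by rw [h0]; ring)
  have htr : Algebra.trace (ZMod 2) F c = 0 := (trace_sq c).symm.trans ha.1
  obtain ⟨y, hy⟩ := exists_trace_mul_eq_one hc
  obtain ⟨l, hl1, hl2⟩ := exists_coords hc hy
  obtain ⟨k, hk1, hk2⟩ := exists_coords hc (y := y + 1) (by
    rw [mul_add, map_add, hy, mul_one, htr, add_zero])
  refine ⟨l, k, ?_⟩
  rw [rho, rhoHat, hl1, hl2, hk1, hk2]
  linear_combination (c ^ 2 * y ^ 2 + c ^ 2 * y + 2 * c * y + c) * CharTwo.two_eq_zero (R := F)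

theorem rho_mem_traceZeroStar {l k : ExteriorLine F} (h : l ≠ k) : rho l k ∈ traceZeroStar F :=
  ⟨trace_rho l k, fun h0 => h ((rho_eq_zero_iff l k).mp h0)⟩

end Transitivity

/-! ### Orbitals -/

section Orbitals

variable {F : Type*} [Field F] [Algebra (ZMod 2) F]

open ExteriorLine

theorem exists_eq_pow_two_pow [Finite F] (σ : F ≃+* F) : ∃ n : ℕ, ∀ a, σ a = a ^ 2 ^ n := by
  let e : F ≃ₐ[ZMod 2] F := AlgEquiv.ofRingEquiv (f := σ) fun c => by
    rcases ZMod.eq_zero_or_eq_one c with rfl | rfl <;> simp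
  obtain ⟨n, hn⟩ := (FiniteField.bijective_frobeniusAlgEquivOfAlgebraic_pow (ZMod 2) F).2 e
  refine ⟨n, fun a => ?_⟩
  have h := DFunLike.congr_fun hn a
  simp only [AlgEquiv.coe_pow, FiniteField.coe_frobeniusAlgEquivOfAlgebraic_iterate, ZMod.card] at h
  exact h.symm

theorem mem_fusionRel [Finite F] {a : F} {p : ExteriorLine F × ExteriorLine F} :
    p ∈ fusionRel a ↔ rho p.1 p.2 ∈ frobeniusOrbit a := by
  simp [fusionRel, mem_ellipticRel]

variable [Fintype F]

theorem mem_orbit_PGLTwo_iff (hF : 4 < Fintype.card F) (p p' : ExteriorLine F × ExteriorLine F) :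
    p' ∈ MulAction.orbit (PGLTwo F) p ↔ rho p'.1 p'.2 = rho p.1 p.2 := by
  constructor
  · rintro ⟨g, rfl⟩
    obtain ⟨σ, hσ, hρ⟩ := rho_smul_smul hF g
    refine (hρ p.1 p.2).trans ?_
    rw [Subgroup.mem_bot.mp hσ, RingAut.one_apply]
  · intro h
    obtain ⟨g, h1, h2⟩ := exists_smul_eq_smul_eq hF ⊥ h.symm
    exact ⟨g, Prod.ext h1 h2⟩

/-- The Frobenius automorphism acts on the exterior lines as an element of `PΓL(2,q)`. -/
theorem exists_frobenius : ∃ g : PGammaLTwo F, ∀ l k : ExteriorLine F,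
    rho (g • l) (g • k) = rho l k ^ 2 := by
  have := charP_two_of_algebra F
  let σ : F ≃+* F := (FiniteField.frobeniusAlgEquivOfAlgebraic (ZMod 2) F).toRingEquiv
  have hσ : ∀ a, σ a = a ^ 2 := fun a => by
    simp [σ, ZMod.card]
  obtain ⟨g, hg⟩ := exists_conicStabilizer_smul_eq_map (Subgroup.mem_top σ)
  refine ⟨g, fun l k => ?_⟩
  rw [← hσ, rho, (hg l).1, (hg l).2, (hg k).1, (hg k).2]
  simp [rho, rhoHat]

theorem mem_orbit_PGammaLTwo_iff (hF : 4 < Fintype.card F)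
    (p p' : ExteriorLine F × ExteriorLine F) :
    p' ∈ MulAction.orbit (PGammaLTwo F) p ↔ rho p'.1 p'.2 ∈ frobeniusOrbit (rho p.1 p.2) := by
  constructor
  · rintro ⟨g, rfl⟩
    obtain ⟨σ, -, hρ⟩ := rho_smul_smul hF g
    obtain ⟨n, hn⟩ := exists_eq_pow_two_pow σ
    exact ⟨n, ((hρ p.1 p.2).trans (hn _)).symm⟩
  · rintro ⟨n, hn⟩
    obtain ⟨τ, hτ⟩ := exists_frobenius (F := F)
    have hτn : ∀ n : ℕ, ∀ l k : ExteriorLine F, rho (τ ^ n • l) (τ ^ n • k) = rho l k ^ 2 ^ n :=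
      fun n l k => by
        induction n with
        | zero => rw [pow_zero, one_smul, one_smul, pow_zero, pow_one]
        | succ n ih => rw [pow_succ', mul_smul, mul_smul, hτ, ih, ← pow_mul, pow_succ]
    obtain ⟨g, h1, h2⟩ := exists_smul_eq_smul_eq hF ⊤ ((hτn n p.1 p.2).trans hn)
    refine ⟨g * τ ^ n, ?_⟩
    refine Prod.ext ?_ ?_
    · exact (mul_smul g (τ ^ n) p.1).trans h1
    · exact (mul_smul g (τ ^ n) p.2).trans h2

theorem frobeniusOrbit_zero (F : Type*) [Field F] : frobeniusOrbit (0 : F) = {0} := by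
  ext a
  simp [frobeniusOrbit, eq_comm]

theorem orbitals_PGLTwo [Nonempty (ExteriorLine F)] (hF : 4 < Fintype.card F) :
    orbitals (PGLTwo F) (ExteriorLine F) = ellipticRelations F := by
  have horb : ∀ p : ExteriorLine F × ExteriorLine F,
      MulAction.orbit (PGLTwo F) p = ellipticRel (rho p.1 p.2) := fun p => by
    ext p'
    rw [mem_orbit_PGLTwo_iff hF, mem_ellipticRel]
  have hdiag : ellipticRel (0 : F) = Set.diagonal (ExteriorLine F) := by
    ext p
    rw [mem_ellipticRel, rho_eq_zero_iff, Set.mem_diagonal_iff]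
  ext R
  simp only [orbitals, ellipticRelations, Set.mem_range, Set.mem_insert_iff, Set.mem_image, horb]
  constructor
  · rintro ⟨p, rfl⟩
    by_cases h : p.1 = p.2
    · left
      rw [(rho_eq_zero_iff _ _).mpr h, hdiag]
    · exact Or.inr ⟨_, rho_mem_traceZeroStar h, rfl⟩
  · rintro (rfl | ⟨a, ha, rfl⟩)
    · obtain ⟨l⟩ := ‹Nonempty (ExteriorLine F)›
      exact ⟨(l, l), by rw [(rho_eq_zero_iff _ _).mpr rfl, hdiag]⟩
    · obtain ⟨l, k, h⟩ := exists_rho_eq ha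
      exact ⟨(l, k), by rw [h]⟩

theorem orbitals_PGammaLTwo [Nonempty (ExteriorLine F)] (hF : 4 < Fintype.card F) :
    orbitals (PGammaLTwo F) (ExteriorLine F) = fusionRelations F := by
  have horb : ∀ p : ExteriorLine F × ExteriorLine F,
      MulAction.orbit (PGammaLTwo F) p = fusionRel (rho p.1 p.2) := fun p => by
    ext p'
    rw [mem_orbit_PGammaLTwo_iff hF, mem_fusionRel]
  have hdiag : fusionRel (0 : F) = Set.diagonal (ExteriorLine F) := by
    ext p
    rw [mem_fusionRel, frobeniusOrbit_zero F, Set.mem_singleton_iff, rho_eq_zero_iff,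
      Set.mem_diagonal_iff]
  ext R
  simp only [orbitals, fusionRelations, Set.mem_range, Set.mem_insert_iff, Set.mem_image, horb]
  constructor
  · rintro ⟨p, rfl⟩
    by_cases h : p.1 = p.2
    · left
      rw [(rho_eq_zero_iff _ _).mpr h, hdiag]
    · exact Or.inr ⟨_, rho_mem_traceZeroStar h, rfl⟩
  · rintro (rfl | ⟨a, ha, rfl⟩)
    · obtain ⟨l⟩ := ‹Nonempty (ExteriorLine F)›
      exact ⟨(l, l), by rw [(rho_eq_zero_iff _ _).mpr rfl, hdiag]⟩
    · obtain ⟨l, k, h⟩ := exists_rho_eq ha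
      exact ⟨(l, k), by rw [h]⟩

end Orbitals

/-! ### Schemes of orbitals and their Bose-Mesner algebras -/

section OrbitalScheme

variable {G X : Type*} [Group G] [MulAction G X]

theorem smul_mem_orbital_iff {R : Set (X × X)} (hR : R ∈ orbitals G X) (g : G) (p : X × X) :
    g • p ∈ R ↔ p ∈ R := by
  obtain ⟨q, rfl⟩ := hR
  refine ⟨fun h => ?_, MulAction.mem_orbit_of_mem_orbit g⟩
  have := MulAction.mem_orbit_of_mem_orbit g⁻¹ h
  rwa [inv_smul_smul] at this

/-- The orbitals of a transitive group whose orbitals are symmetric form an association scheme. -/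
theorem isAssociationScheme_orbitals (hdiag : Set.diagonal X ∈ orbitals G X)
    (hsymm : ∀ x y : X, (y, x) ∈ MulAction.orbit G (x, y)) :
    IsAssociationScheme (orbitals G X) where
  isPartition := by
    refine ⟨?_, fun p => ⟨MulAction.orbit G p, ⟨⟨p, rfl⟩, MulAction.mem_orbit_self p⟩, ?_⟩⟩
    · rintro ⟨p, hp⟩
      exact (MulAction.nonempty_orbit p).ne_empty hp
    · rintro _ ⟨⟨q, rfl⟩, hq⟩
      exact (MulAction.orbit_eq_iff.mpr hq).symm
  diagonal_mem := hdiag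
  symmetric := by
    rintro _ ⟨q, rfl⟩ x y hxy
    change (x, y) ∈ MulAction.orbit G q at hxy
    change (y, x) ∈ MulAction.orbit G q
    rw [← MulAction.orbit_eq_iff.mpr hxy]
    exact hsymm x y
  intersection := by
    rintro A hA B hB _ ⟨⟨x₀, y₀⟩, rfl⟩
    refine ⟨{z : X | (x₀, z) ∈ A ∧ (z, y₀) ∈ B}.ncard, ?_⟩
    rintro _ _ ⟨g, hg⟩
    obtain ⟨rfl, rfl⟩ := Prod.mk.inj hg
    rw [← Set.ncard_image_of_injective {z : X | (x₀, z) ∈ A ∧ (z, y₀) ∈ B}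
      (MulAction.injective g)]
    congr 1
    ext z
    obtain ⟨z, rfl⟩ := MulAction.surjective g z
    rw [(MulAction.injective g).mem_set_image]
    exact and_congr (smul_mem_orbital_iff hA g (x₀, z)) (smul_mem_orbital_iff hB g (z, y₀))

/-- The Bose-Mesner algebra of the orbitals of `G` is the centralizer algebra of `G`. -/
theorem mem_boseMesnerAlgebra_orbitals_iff [Fintype X] [DecidableEq X] (M : Matrix X X ℝ) :
    M ∈ boseMesnerAlgebra (orbitals G X) ↔ ∀ (g : G) (x y : X), M (g • x) (g • y) = M x y := by
  constructor
  · intro hM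
    induction hM using Algebra.adjoin_induction with
    | mem M hM =>
      obtain ⟨R, hR, rfl⟩ := hM
      intro g x y
      have h : (g • x, g • y) ∈ R ↔ (x, y) ∈ R := smul_mem_orbital_iff hR g (x, y)
      rw [adjacencyMatrix, Matrix.of_apply, Matrix.of_apply]
      by_cases hxy : (x, y) ∈ R
      · rw [Set.indicator_of_mem hxy, Set.indicator_of_mem (h.mpr hxy)]
      · rw [Set.indicator_of_notMem hxy, Set.indicator_of_notMem (mt h.mp hxy)]
    | algebraMap r =>
      intro g x y
      simp [Matrix.algebraMap_matrix_apply]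
    | add M N _ _ hM hN =>
      intro g x y
      rw [Matrix.add_apply, Matrix.add_apply, hM, hN]
    | mul M N _ _ hM hN =>
      intro g x y
      rw [Matrix.mul_apply, Matrix.mul_apply, ← Equiv.sum_comp (MulAction.toPerm g)]
      exact Finset.sum_congr rfl fun z _ => congrArg₂ _ (hM g x z) (hN g z y)
  · intro hM
    have key : M = ∑ p : X × X, (M p.1 p.2 / (MulAction.orbit G p).ncard) •
        adjacencyMatrix (MulAction.orbit G p) := by
      ext x y
      have hfin : (MulAction.orbit G (x, y)).Finite := Set.toFinite _
      have hterm : ∀ p : X × X, ((M p.1 p.2 / (MulAction.orbit G p).ncard) •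
          adjacencyMatrix (MulAction.orbit G p)) x y =
          if p ∈ hfin.toFinset then M x y / (MulAction.orbit G (x, y)).ncard else 0 := fun p => by
        rw [Matrix.smul_apply, adjacencyMatrix, Matrix.of_apply, smul_eq_mul]
        by_cases hp : p ∈ hfin.toFinset
        · have hp' := hfin.mem_toFinset.mp hp
          have horb := MulAction.orbit_eq_iff.mpr hp'
          rw [if_pos hp, Set.indicator_of_mem (horb ▸ MulAction.mem_orbit_self (x, y)), mul_one,
            horb]
          obtain ⟨g, rfl⟩ := hp'
          exact congrArg (· / _) (hM g x y)
        · rw [if_neg hp, Set.indicator_of_notMem (fun h => hp (hfin.mem_toFinset.mpr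
            (MulAction.mem_orbit_symm.mp h))), mul_zero]
      rw [Matrix.sum_apply, Finset.sum_congr rfl fun p _ => hterm p, Finset.sum_ite_mem,
        Finset.univ_inter, Finset.sum_const, ← Set.ncard_eq_toFinset_card _ hfin, nsmul_eq_mul]
      have hpos : ((MulAction.orbit G (x, y)).ncard : ℝ) ≠ 0 := by
        rw [Nat.cast_ne_zero]
        exact Set.ncard_ne_zero_of_mem (MulAction.mem_orbit_self (x, y)) hfin
      field_simp
    rw [key]
    exact Subalgebra.sum_mem _ fun p _ => Subalgebra.smul_mem _
      (Algebra.subset_adjoin (Set.mem_image_of_mem _ (Set.mem_range_self p))) _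

end OrbitalScheme

section EllipticBoseMesner

variable {F : Type*} [Field F] [Algebra (ZMod 2) F] [Fintype F]

open ExteriorLine

theorem mem_boseMesnerAlgebra_PGLTwo_iff (hF : 4 < Fintype.card F)
    (M : Matrix (ExteriorLine F) (ExteriorLine F) ℝ) :
    M ∈ boseMesnerAlgebra (orbitals (PGLTwo F) (ExteriorLine F)) ↔ ∃ f, M = distMatrix rho f := by
  classical
  rw [mem_boseMesnerAlgebra_orbitals_iff]
  constructor
  · intro h
    refine ⟨fun a => if ha : ∃ p : ExteriorLine F × ExteriorLine F, rho p.1 p.2 = a then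
      M ha.choose.1 ha.choose.2 else 0, ?_⟩
    ext l k
    have ha : ∃ p : ExteriorLine F × ExteriorLine F, rho p.1 p.2 = rho l k := ⟨(l, k), rfl⟩
    rw [distMatrix, Matrix.of_apply, dif_pos ha]
    obtain ⟨g, h1, h2⟩ := exists_smul_eq_smul_eq_bot hF ha.choose_spec
    rw [← h g ha.choose.1 ha.choose.2, h1, h2]
  · rintro ⟨f, rfl⟩ g l k
    obtain ⟨σ, hσ, hρ⟩ := rho_smul_smul hF g
    rw [distMatrix, Matrix.of_apply, Matrix.of_apply, hρ, Subgroup.mem_bot.mp hσ,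
      RingAut.one_apply]

theorem frobeniusOrbit_sq (a : F) : frobeniusOrbit (a ^ 2) = frobeniusOrbit a := by
  have := charP_two_of_algebra F
  obtain ⟨n, hn, hc⟩ := FiniteField.card F 2
  ext b
  constructor
  · rintro ⟨i, rfl⟩
    exact ⟨i + 1, by simp only [pow_succ', pow_mul]⟩
  · rintro ⟨i, rfl⟩
    refine ⟨i + n - 1, ?_⟩
    have e : 2 * 2 ^ (i + n - 1) = Fintype.card F * 2 ^ i := by
      rw [hc, ← pow_succ', ← pow_add]
      congr 1
      have := n.pos
      omega
    simp only
    rw [← pow_mul, e, pow_mul, FiniteField.pow_card]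

theorem mem_boseMesnerAlgebra_PGammaLTwo_iff (hF : 4 < Fintype.card F)
    (M : Matrix (ExteriorLine F) (ExteriorLine F) ℝ) :
    M ∈ boseMesnerAlgebra (orbitals (PGammaLTwo F) (ExteriorLine F)) ↔
      ∃ f, (∀ a, f (a ^ 2) = f a) ∧ M = distMatrix rho f := by
  classical
  rw [mem_boseMesnerAlgebra_orbitals_iff]
  constructor
  · intro h
    refine ⟨fun a => if ha : ∃ p : ExteriorLine F × ExteriorLine F,
      rho p.1 p.2 ∈ frobeniusOrbit a then M ha.choose.1 ha.choose.2 else 0, fun a => ?_, ?_⟩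
    · simp only [frobeniusOrbit_sq]
    · ext l k
      have ha : ∃ p : ExteriorLine F × ExteriorLine F, rho p.1 p.2 ∈ frobeniusOrbit (rho l k) :=
        ⟨(l, k), 0, by simp⟩
      rw [distMatrix, Matrix.of_apply, dif_pos ha]
      obtain ⟨g, hg⟩ := (mem_orbit_PGammaLTwo_iff hF (l, k) ha.choose).mpr ha.choose_spec
      rw [← hg]
      exact (h g l k).symm
  · rintro ⟨f, hf, rfl⟩ g l k
    obtain ⟨σ, -, hρ⟩ := rho_smul_smul hF g
    obtain ⟨n, hn⟩ := exists_eq_pow_two_pow σ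
    rw [distMatrix, Matrix.of_apply, Matrix.of_apply, hρ, hn]
    generalize rho l k = a
    clear hn
    induction n with
    | zero => rw [pow_zero, pow_one]
    | succ n ih => rw [pow_succ, pow_mul, hf, ih]

end EllipticBoseMesner

/-! ### Counting exterior lines -/

section Counting

variable {F : Type*} [Field F] [Algebra (ZMod 2) F] [Fintype F]

open ExteriorLine

open scoped Classical in
theorem card_filter_coords (P : F → F → Prop) :
    (Finset.univ.filter fun l : ExteriorLine F => P l.fst l.snd).card =
      (Finset.univ.filter fun p : F × F =>
        Algebra.trace (ZMod 2) F (p.1 * p.2) = 1 ∧ P p.1 p.2).card := by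
  refine Finset.card_bij (fun l _ => (l.fst, l.snd)) ?_ ?_ ?_
  · intro l hl
    rw [Finset.mem_filter] at hl ⊢
    exact ⟨Finset.mem_univ _, l.trace_mul, hl.2⟩
  · intro l _ k _ h
    exact ext_coords (Prod.mk.inj h).1 (Prod.mk.inj h).2
  · rintro ⟨x, y⟩ h
    rw [Finset.mem_filter] at h
    obtain ⟨-, htr, hP⟩ := h
    have hx : x ≠ 0 := by
      rintro rfl
      simp at htr
    obtain ⟨l, rfl, rfl⟩ := exists_coords hx htr
    exact ⟨l, Finset.mem_filter.mpr ⟨Finset.mem_univ _, hP⟩, rfl⟩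

theorem two_mul_card_filter_trace_mul {a : F} (ha : a ≠ 0) :
    2 * (Finset.univ.filter fun b => Algebra.trace (ZMod 2) F (a * b) = 1).card =
      Fintype.card F := by
  obtain ⟨b, hb⟩ := exists_trace_mul_eq_one ha
  exact two_mul_card_filter_eq_one
    ((Algebra.trace (ZMod 2) F).toAddMonoidHom.comp (AddMonoidHom.mulLeft a))
    ⟨b, by
      change Algebra.trace (ZMod 2) F (a * b) ≠ 0
      rw [hb]
      exact one_ne_zero⟩

theorem two_mul_card_exteriorLine :
    2 * Fintype.card (ExteriorLine F) = Fintype.card F * (Fintype.card F - 1) := by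
  classical
  have h := card_filter_coords (F := F) fun _ _ => True
  simp only [and_true, Finset.filter_true, Finset.card_univ] at h
  rw [h, Finset.card_filter, Fintype.sum_prod_type, Finset.mul_sum,
    ← Finset.add_sum_erase _ _ (Finset.mem_univ (0 : F))]
  have h0 : 2 * ∑ y : F, (if Algebra.trace (ZMod 2) F (0 * y) = 1 then 1 else 0) = 0 := by simp
  rw [h0, zero_add, Finset.sum_congr rfl fun x hx => by
    rw [← Finset.card_filter, two_mul_card_filter_trace_mul (Finset.ne_of_mem_erase hx)]]
  rw [Finset.sum_const, Finset.card_erase_of_mem (Finset.mem_univ _), Finset.card_univ,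
    smul_eq_mul, mul_comm]

open scoped Classical in
/-- Affine lines `a u + b z = s` of the `(z, u)`-plane on which `Tr(zu)` is not constant. -/
theorem two_mul_card_filter_affine_line {a b s : F} (hab : a ≠ 0 ∨ b ≠ 0) (hs : s ^ 2 ≠ a * b) :
    2 * (Finset.univ.filter fun p : F × F =>
      Algebra.trace (ZMod 2) F (p.1 * p.2) = 1 ∧ a * p.2 + b * p.1 = s).card = Fintype.card F := by
  have := charP_two_of_algebra F
  have h2 := CharTwo.two_eq_zero (R := F)
  classical
  wlog ha : a ≠ 0 generalizing a b
  · rw [← this hab.symm (by rwa [mul_comm]) (hab.resolve_left ha)]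
    congr 1
    refine Finset.card_bij' (fun p _ => (p.2, p.1)) (fun p _ => (p.2, p.1)) ?_ ?_
      (fun _ _ => rfl) (fun _ _ => rfl) <;>
    · intro p hp
      rw [Finset.mem_filter] at hp ⊢
      refine ⟨Finset.mem_univ _, ?_, ?_⟩
      · rw [mul_comm]; exact hp.2.1
      · rw [add_comm]; exact hp.2.2
  obtain ⟨β, hβ⟩ := exists_sq_eq (b / a)
  have hne : s / a + β ≠ 0 := fun h0 => hs <| by
    have h1 := CharTwo.add_eq_zero.mp h0
    have h3 : (s / a) ^ 2 = b / a := by rw [h1, hβ]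
    field_simp at h3
    linear_combination h3
  -- on the line, `zu = z s / a + z² b / a` has the same trace as `z (s / a + β)`
  have htr : ∀ z : F, Algebra.trace (ZMod 2) F (z * ((s + b * z) / a)) =
      Algebra.trace (ZMod 2) F ((s / a + β) * z) := fun z => by
    have e : z * ((s + b * z) / a) = s / a * z + (β * z) ^ 2 := by
      rw [mul_pow, hβ]
      field_simp
    rw [e, map_add, trace_sq, ← map_add, add_mul]
  rw [← two_mul_card_filter_trace_mul hne]
  congr 1
  refine Finset.card_bij' (fun p _ => p.1) (fun z _ => (z, (s + b * z) / a)) ?_ ?_ ?_ ?_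
  · intro p hp
    rw [Finset.mem_filter] at hp ⊢
    obtain ⟨-, h1, h3⟩ := hp
    have : p.2 = (s + b * p.1) / a := by
      rw [eq_div_iff ha]
      linear_combination h3 - b * p.1 * h2
    rw [this, htr] at h1
    exact ⟨Finset.mem_univ _, h1⟩
  · intro z hz
    rw [Finset.mem_filter] at hz ⊢
    refine ⟨Finset.mem_univ _, (htr z).trans hz.2, ?_⟩
    rw [mul_div_cancel₀ _ ha]
    linear_combination b * z * h2
  · intro p hp
    rw [Finset.mem_filter] at hp
    refine Prod.ext rfl ?_
    rw [div_eq_iff ha]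
    linear_combination (-1 : F) * hp.2.2 + b * p.1 * h2
  · intro z _
    rfl

open scoped Classical in
/-- The lines equidistant from two given ones form, in the `(x, y)`-plane, a pair of parallel affine
lines. -/
theorem card_filter_rho_eq_rho {l k : ExteriorLine F} (hlk : l ≠ k) :
    (Finset.univ.filter fun n => rho l n = rho n k).card = Fintype.card F := by
  have := charP_two_of_algebra F
  have h2 := CharTwo.two_eq_zero (R := F)
  obtain ⟨s, hs⟩ := exists_sq_add_self_eq (a := l.fst * l.snd + k.fst * k.snd) (by
    rw [map_add, trace_mul, trace_mul]; rfl)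
  have hab : l.fst + k.fst ≠ 0 ∨ l.snd + k.snd ≠ 0 := by
    by_contra hcon
    rw [not_or, not_not, not_not] at hcon
    exact hlk (ext_coords (CharTwo.add_eq_zero.mp hcon.1) (CharTwo.add_eq_zero.mp hcon.2))
  have hsq : ∀ s : F, s ^ 2 + s = l.fst * l.snd + k.fst * k.snd →
      s ^ 2 ≠ (l.fst + k.fst) * (l.snd + k.snd) := fun s hs h0 => by
    have hS : s = l.fst * k.snd + l.snd * k.fst := by
      linear_combination hs - h0 - (l.fst * k.snd + l.snd * k.fst) * h2
    refine hlk ((rho_eq_zero_iff l k).mp ?_)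
    rw [hS] at h0
    rw [rho, rhoHat]
    linear_combination h0 + ((l.fst + k.fst) * (l.snd + k.snd) - l.fst * k.snd * l.snd * k.fst) * h2
  have hs1 : (s + 1) ^ 2 + (s + 1) = l.fst * l.snd + k.fst * k.snd := by
    linear_combination hs + (s + 1) * h2
  have hiff : ∀ z u : F, rhoHat l.fst l.snd z u = rhoHat z u k.fst k.snd ↔
      ((l.fst + k.fst) * u + (l.snd + k.snd) * z = s ∨
        (l.fst + k.fst) * u + (l.snd + k.snd) * z = s + 1) := fun z u => by
    rw [← sub_eq_zero (b := s), ← sub_eq_zero (b := s + 1), ← mul_eq_zero, ← sub_eq_zero, rhoHat,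
      rhoHat]
    have e : l.fst ^ 2 * u ^ 2 + l.snd ^ 2 * z ^ 2 + (l.fst + z) * (l.snd + u) -
        (z ^ 2 * k.snd ^ 2 + u ^ 2 * k.fst ^ 2 + (z + k.fst) * (u + k.snd)) =
        ((l.fst + k.fst) * u + (l.snd + k.snd) * z - s) *
          ((l.fst + k.fst) * u + (l.snd + k.snd) * z - (s + 1)) := by
      linear_combination (l.fst * u + l.snd * z - z ^ 2 * k.snd ^ 2 - u ^ 2 * k.fst ^ 2 -
        k.fst * k.snd - l.fst * k.fst * u ^ 2 - l.snd * k.snd * z ^ 2 -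
        (l.fst + k.fst) * (l.snd + k.snd) * u * z +
        s * ((l.fst + k.fst) * u + (l.snd + k.snd) * z)) * h2 - hs
    rw [e]
  have hcard := card_filter_coords fun z u => rhoHat l.fst l.snd z u = rhoHat z u k.fst k.snd
  refine hcard.trans ?_
  simp only [hiff, and_or_left, Finset.filter_or]
  rw [Finset.card_union_of_disjoint]
  · have e1 := two_mul_card_filter_affine_line hab (hsq s hs)
    have e2 := two_mul_card_filter_affine_line hab (hsq (s + 1) hs1)
    refine Nat.eq_of_mul_eq_mul_left two_pos ?_
    rw [mul_add]
    convert congrArg₂ (· + ·) e1 e2 using 1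
    rw [two_mul]
  · rw [Finset.disjoint_filter]
    rintro p - ⟨-, h1⟩ ⟨-, h3⟩
    rw [h1] at h3
    exact one_ne_zero (left_eq_add.mp h3)

theorem norm_form_eq_zero_iff {c : F} (hc : Algebra.trace (ZMod 2) F c = 1) (s w : F) :
    s ^ 2 + s * w + c * w ^ 2 = 0 ↔ s = 0 ∧ w = 0 := by
  have := charP_two_of_algebra F
  constructor
  · intro h
    by_cases hw : w = 0
    · rw [hw, mul_zero, add_zero, zero_pow two_ne_zero, mul_zero, add_zero] at h
      exact ⟨pow_eq_zero_iff two_ne_zero |>.mp h, hw⟩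
    · exfalso
      have : c = (s / w) ^ 2 + s / w := by
        rw [← CharTwo.add_eq_zero]
        field_simp
        linear_combination h
      rw [this, trace_sq_add_self] at hc
      exact zero_ne_one hc
  · rintro ⟨rfl, rfl⟩
    ring

open scoped Classical in
/-- Each nonzero value is taken `q + 1` times by the norm form of the quadratic extension. -/
theorem card_filter_norm_form {c : F} (hc : Algebra.trace (ZMod 2) F c = 1) {a : F} (ha : a ≠ 0) :
    (Finset.univ.filter fun p : F × F => p.1 ^ 2 + p.1 * p.2 + c * p.2 ^ 2 = a).card =
      Fintype.card F + 1 := by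
  have hscale : ∀ b ∈ Finset.univ.erase (0 : F),
      (Finset.univ.filter fun p : F × F => p.1 ^ 2 + p.1 * p.2 + c * p.2 ^ 2 = b).card =
      (Finset.univ.filter fun p : F × F => p.1 ^ 2 + p.1 * p.2 + c * p.2 ^ 2 = a).card := by
    intro b hb
    have hb0 := Finset.ne_of_mem_erase hb
    obtain ⟨t, ht⟩ := exists_sq_eq (a / b)
    have ht0 : t ≠ 0 := fun h0 => by
      rw [h0, zero_pow two_ne_zero, eq_comm, div_eq_zero_iff] at ht
      exact ht.elim ha hb0
    have hab : a = t ^ 2 * b := by rw [ht, div_mul_cancel₀ _ hb0]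
    refine Finset.card_bij' (fun p _ => (t * p.1, t * p.2)) (fun p _ => (p.1 / t, p.2 / t))
      ?_ ?_ ?_ ?_
    · intro p hp
      rw [Finset.mem_filter] at hp ⊢
      refine ⟨Finset.mem_univ _, ?_⟩
      rw [hab]
      linear_combination t ^ 2 * hp.2
    · intro p hp
      rw [Finset.mem_filter] at hp ⊢
      refine ⟨Finset.mem_univ _, ?_⟩
      have h1 := hp.2
      rw [hab] at h1
      field_simp
      linear_combination h1
    · intro p _
      simp [ht0]
    · intro p _
      refine Prod.ext ?_ ?_ <;> exact mul_div_cancel₀ _ ht0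
  have htot := Finset.card_eq_sum_card_fiberwise (s := (Finset.univ : Finset (F × F)))
    (t := (Finset.univ : Finset F)) (f := fun p : F × F => p.1 ^ 2 + p.1 * p.2 + c * p.2 ^ 2)
    (fun _ _ => Finset.mem_coe.mpr (Finset.mem_univ _))
  rw [← Finset.add_sum_erase _ _ (Finset.mem_univ (0 : F)), Finset.sum_congr rfl hscale,
    Finset.sum_const, Finset.card_erase_of_mem (Finset.mem_univ _), Finset.card_univ,
    Finset.card_univ, Fintype.card_prod, smul_eq_mul] at htot
  have hzero : (Finset.univ.filter fun p : F × F => p.1 ^ 2 + p.1 * p.2 + c * p.2 ^ 2 = 0) =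
      {(0, 0)} := by
    ext p
    rw [Finset.mem_filter, norm_form_eq_zero_iff hc, Finset.mem_singleton, Prod.ext_iff]
    exact and_iff_right (Finset.mem_univ _)
  rw [hzero, Finset.card_singleton] at htot
  have hq : 1 < Fintype.card F := Fintype.one_lt_card
  obtain ⟨n, hn⟩ := Nat.exists_eq_add_of_lt hq
  rw [hn] at htot ⊢
  have e : 1 + n + 1 - 1 = n + 1 := by omega
  rw [e] at htot
  refine Nat.eq_of_mul_eq_mul_left (Nat.succ_pos n) ?_
  rw [Nat.succ_eq_add_one]
  linarith

open scoped Classical in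
theorem card_filter_rho_eq (l : ExteriorLine F) {a : F} (ha : a ∈ traceZeroStar F) :
    (Finset.univ.filter fun k => rho l k = a).card = Fintype.card F + 1 := by
  have := charP_two_of_algebra F
  have h2 := CharTwo.two_eq_zero (R := F)
  have hx := l.fst_ne_zero
  have htr := l.trace_mul
  rw [← card_filter_norm_form htr ha.2]
  have hcard := card_filter_coords fun z u => rhoHat l.fst l.snd z u = a
  refine hcard.trans ?_
  set x := l.fst
  set y := l.snd
  have hform : ∀ s w : F, rhoHat x y (x * (w + 1)) ((s + y * (x * (w + 1))) / x) =
      s ^ 2 + s * w + x * y * w ^ 2 := fun s w => by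
    have e := mul_div_cancel₀ (s + y * (x * (w + 1))) hx
    rw [rhoHat]
    generalize (s + y * (x * (w + 1))) / x = u at e ⊢
    linear_combination (x * u + s + y * (x * (w + 1)) + (w + 2)) * e +
      (s + x * y * (2 * w + 2) + s * y * (x * (w + 1)) + (y * (x * (w + 1))) ^ 2) * h2
  have hform' : ∀ z u : F, (x * u + y * z) ^ 2 + (x * u + y * z) * (z / x + 1) +
      x * y * (z / x + 1) ^ 2 = rhoHat x y z u := fun z u => by
    have e := mul_div_cancel₀ z hx
    rw [rhoHat]
    generalize z / x = v at e ⊢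
    linear_combination (u + y * v) * e + (x * u * y * z + y * z * v + x * y * v) * h2
  have htr' : ∀ z u : F, rhoHat x y z u = a → Algebra.trace (ZMod 2) F (z * u) = 1 :=
    fun z u h => by
      have e : z * u = ((x * u + y * z) ^ 2 + (x * u + y * z)) + (x * y + a) := by
        rw [← h, rhoHat]
        linear_combination -(x ^ 2 * u ^ 2 + y ^ 2 * z ^ 2 + x * y * u * z + x * u + y * z +
          x * y) * h2
      rw [e, map_add, trace_sq_add_self, map_add, htr, ha.1]
      rfl
  refine Finset.card_bij' (fun p _ => (x * p.2 + y * p.1, p.1 / x + 1))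
    (fun p _ => (x * (p.2 + 1), (p.1 + y * (x * (p.2 + 1))) / x)) ?_ ?_ ?_ ?_
  · intro p hp
    rw [Finset.mem_filter] at hp ⊢
    exact ⟨Finset.mem_univ _, (hform' _ _).trans hp.2.2⟩
  · intro p hp
    rw [Finset.mem_filter] at hp ⊢
    have h := (hform _ _).trans hp.2
    exact ⟨Finset.mem_univ _, htr' _ _ h, h⟩
  · intro p _
    have e : x * (p.1 / x + 1 + 1) = p.1 := by
      field_simp
      linear_combination x * h2
    refine Prod.ext e ?_
    simp only [e]
    rw [div_eq_iff hx]
    linear_combination y * p.1 * h2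
  · intro p _
    refine Prod.ext ?_ ?_
    · simp only
      rw [mul_div_cancel₀ _ hx]
      linear_combination y * (x * (p.2 + 1)) * h2
    · simp only
      rw [mul_div_cancel_left₀ _ hx]
      linear_combination h2

end Counting

/-! ### The elliptic distance function and the Frobenius map -/

section FrobeniusFusion

variable {F : Type*} [Field F] [Algebra (ZMod 2) F] [Fintype F]

open ExteriorLine

open scoped Classical in
theorem isPseudocyclicDistance_rho : IsPseudocyclicDistance (rho (F := F))
    (Finset.univ.filter (· ∈ traceZeroStar F)) (Fintype.card F + 1) where
  symm := rho_comm
  eq_zero_iff := rho_eq_zero_iff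
  mem l k h := Finset.mem_filter.mpr ⟨Finset.mem_univ _, rho_mem_traceZeroStar h⟩
  zero_notMem h := (Finset.mem_filter.mp h).2.2 rfl
  valency l a ha := card_filter_rho_eq l (Finset.mem_filter.mp ha).2
  count l k h := by rw [card_filter_rho_eq_rho h]

open scoped Classical in
theorem isFrobeniusPair_rho {m : ℕ} (hodd : Odd m) (hF : Fintype.card F = 2 ^ m) :
    ∃ τ : Equiv.Perm (ExteriorLine F), IsFrobeniusPair (rho (F := F))
      (Finset.univ.filter (· ∈ traceZeroStar F)) m τ (fun a => a ^ 2) := by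
  obtain ⟨g, hg⟩ := exists_frobenius (F := F)
  refine ⟨MulAction.toPerm g, hg, fun a => ?_, fun a ha => ?_, fun a ha h => ?_⟩
  · rw [pow_iterate, ← hF]
    exact FiniteField.pow_card a
  · rw [Finset.mem_filter] at ha ⊢
    exact ⟨Finset.mem_univ _, (trace_sq a).trans ha.2.1, pow_ne_zero 2 ha.2.2⟩
  · rw [Finset.mem_filter] at ha
    obtain ⟨-, htr, ha0⟩ := ha
    have h1 : a = 1 := mul_left_cancel₀ ha0 (by rw [mul_one, ← pow_two]; exact h)
    have hrank : Module.finrank (ZMod 2) F = m := by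
      have := Module.card_eq_pow_finrank (K := ZMod 2) (V := F)
      rw [hF, ZMod.card] at this
      exact (Nat.pow_right_injective le_rfl this).symm
    rw [h1, ← map_one (algebraMap (ZMod 2) F), Algebra.trace_algebraMap, hrank, nsmul_eq_mul,
      mul_one, ZMod.natCast_eq_zero_iff_even] at htr
    exact Nat.not_even_iff_odd.mpr hodd htr

end FrobeniusFusion

theorem mainTheorem1 (m : ℕ) (hm : m.Prime) (hodd : Odd m)
    (F : Type*) [Field F] [Fintype F] [Algebra (ZMod 2) F] (hF : Fintype.card F = 2 ^ m) :
    Fintype.card (ExteriorLine F) = 2 ^ m * (2 ^ m - 1) / 2 ∧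
    orbitals (PGLTwo F) (ExteriorLine F) = ellipticRelations F ∧
    orbitals (PGammaLTwo F) (ExteriorLine F) = fusionRelations F ∧
    IsPseudocyclic (fusionRelations F) := by
  classical
  have h4 : 4 < Fintype.card F := by
    have h3 : 2 < m := lt_of_le_of_ne hm.two_le fun h => by
      rw [← h] at hodd
      exact absurd hodd (by decide)
    rw [hF]
    exact Nat.pow_lt_pow_right one_lt_two h3
  have hcard := two_mul_card_exteriorLine (F := F)
  have : Nonempty (ExteriorLine F) := by
    rw [← Fintype.card_pos_iff]
    have : 0 < Fintype.card F * (Fintype.card F - 1) := Nat.mul_pos (by omega) (by omega)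
    omega
  have hPGL := orbitals_PGLTwo (F := F) h4
  have hPGammaL := orbitals_PGammaLTwo (F := F) h4
  have : Fact m.Prime := ⟨hm⟩
  refine ⟨by rw [← hF]; omega, hPGL, hPGammaL, ?_, m * (Fintype.card F + 1), fun E hE hne => ?_⟩
  · rw [← hPGammaL]
    refine isAssociationScheme_orbitals ?_ fun l k => ?_
    · rw [hPGammaL]
      exact Set.mem_insert _ _
    · rw [mem_orbit_PGammaLTwo_iff h4, ExteriorLine.rho_comm]
      exact ⟨0, by simp⟩
  · rw [← hPGammaL] at hE
    obtain ⟨τ, hτ⟩ := isFrobeniusPair_rho hodd hF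
    exact hτ.rank_eq isPseudocyclicDistance_rho (mem_boseMesnerAlgebra_PGLTwo_iff h4)
      (mem_boseMesnerAlgebra_PGammaLTwo_iff h4) hE hne
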